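/- Consider the trihexagonal tiling of $\mathbb R^2$ (the edge-to-edge tiling by equilateral triangles and regular hexagons with a triangle and a hexagon meeting at each edge), with unit edges and with the hexagon centers at the points of $2\Lambda$, where $\Lambda$ is the lattice generated by $(1,0)$ and $(-\tfrac12,\tfrac{\sqrt3}2)$. The refractive flow $T^t$ on the unit tangent bundle $X$ of the plane moves a unit vector at unit speed along straight lines inside the tiles; when it crosses the interior of an edge, its direction is reflected across the line of the edge and then reversed (so the trajectory passes into the other tile, the component of the velocity along the edge changes sign, and the normal component is unchanged). Trajectories are not continued through vertices of the tiling; a trajectory is non-singular if it is defined for all $t\in\mathbb R$. A trajectory is bounded if its base points stay in a bounded subset of the plane, periodic if $T^{t+P}(x)=T^t(x)$ for some $P>0$ and all $t \in \mathbb R$, and drift-periodic if its orbit $\{T^t(x):t\in\mathbb R\}$ is invariant under a non-trivial translational symmetry of the tiling. For $x\in X$ let $|T^t(x)|$ be the distance from the base point of $T^t(x)$ to the origin. Then: (a) Every non-singular bounded trajectory is periodic. (b) If $x\in X$ has a non-singular trajectory, then the limit $\lim_{t\to+\infty}|T^t(x)|/t$ exists. It is $0$ if the trajectory is not drift-periodic,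 and it is a positive real number (which may depend on the trajectory) if the trajectory is drift-periodic. -/

import Mathlib

open Complex Filter Topology ComplexConjugate

noncomputable section

namespace Trihex

/-- The primitive sixth root of unity `1/2 + (√3/2) i`. -/
def zeta : ℂ := ⟨1 / 2, Real.sqrt 3 / 2⟩

/-- The Eisenstein lattice, generated by `(1, 0)`, `(-1/2, √3/2)` and `(-1/2, -√3/2)`;
the plane `ℝ²` is identified with `ℂ`. -/
def eisenstein : AddSubgroup ℂ :=
  AddSubgroup.closure {1, ⟨-1 / 2, Real.sqrt 3 / 2⟩, ⟨-1 / 2, -(Real.sqrt 3 / 2)⟩}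

/-- The centers of the hexagons of the tiling are the points of twice the Eisenstein lattice. -/
def IsHexCenter (c : ℂ) : Prop := ∃ z ∈ eisenstein, c = 2 * z

/-- The vertices of the trihexagonal tiling with unit edges: the hexagon with center `c` has
the vertices `c + ζ ^ k`, and every vertex of the tiling is a vertex of a hexagon. -/
def IsVertex (p : ℂ) : Prop := ∃ c, IsHexCenter c ∧ ∃ k : ℕ, p = c + zeta ^ k

/-- `a` and `b` are the two ends of an edge of the tiling. Each edge of the trihexagonal tiling
separates a hexagon from a triangle, so the edges are the sides of the hexagons. -/
def IsEdge (a b : ℂ) : Prop :=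
  ∃ c, IsHexCenter c ∧ ∃ k : ℕ,
    (a = c + zeta ^ k ∧ b = c + zeta ^ (k + 1)) ∨ (a = c + zeta ^ (k + 1) ∧ b = c + zeta ^ k)

/-- The translation by `τ` is a symmetry of the tiling. -/
def IsTranslationalSymmetry (τ : ℂ) : Prop :=
  ∀ a b : ℂ, IsEdge a b ↔ IsEdge (a + τ) (b + τ)

/-- The unit tangent bundle of the plane: a base point and a unit vector. -/
abbrev UnitTangent : Type := ℂ × Circle

/-- Refraction with coefficient `-1` across a line with direction `u`: the vector `v` is
reflected across the line `ℝ u`, and then reversed so that the ray goes on across the line.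
The component of `v` along `u` changes its sign and the normal component stays the same. -/
def refract (u v : ℂ) : ℂ := -(u * conj (v / u))

/-- `v` is the direction in which a trajectory arrives at the base point of `x` if it leaves
that point in the direction of `x`: the direction is unchanged at an interior point of a tile,
and it is refracted at an interior point of an edge. -/
def IsIncoming (x : UnitTangent) (v : Circle) : Prop :=
  ((∀ a b, IsEdge a b → x.1 ∉ openSegment ℝ a b) → v = x.2) ∧
  (∀ a b, IsEdge a b → x.1 ∈ openSegment ℝ a b → (x.2 : ℂ) = refract (b - a) v)

/-- `Γ` is a non-singular trajectory `t ↦ Tᵗ(x)`, with `x = Γ 0`, of the refractive flow: it is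
defined for all times, never meets a vertex, and moves along straight segments at unit speed,
with refraction at the edges. At a time when the trajectory crosses an edge, the second component
of `Γ` is the outgoing direction. (Motion along an edge is excluded: by `incoming`
it would have to reverse its direction at each time; such a ray ends in a vertex anyway.) -/
structure IsTrajectory (Γ : ℝ → UnitTangent) : Prop where
  not_vertex : ∀ t, ¬ IsVertex (Γ t).1
  outgoing : ∀ t, ∀ᶠ s in 𝓝[>] t,
    Γ s = ((Γ t).1 + ((s - t : ℝ) : ℂ) * ((Γ t).2 : ℂ), (Γ t).2)
  incoming : ∀ t, ∃ v : Circle, IsIncoming (Γ t) v ∧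
    ∀ᶠ s in 𝓝[<] t, Γ s = ((Γ t).1 + ((s - t : ℝ) : ℂ) * (v : ℂ), v)

/-- The trajectory stays in a bounded region of the plane. -/
def IsBoundedTrajectory (Γ : ℝ → UnitTangent) : Prop :=
  Bornology.IsBounded (Set.range fun t => (Γ t).1)

/-- The trajectory is periodic (in the unit tangent bundle). -/
def IsPeriodic (Γ : ℝ → UnitTangent) : Prop :=
  ∃ P : ℝ, 0 < P ∧ ∀ t, Γ (t + P) = Γ t

/-- The trajectory is drift-periodic: as a set of unit tangent vectors it is invariant under a
non-trivial translational symmetry of the tiling. -/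
def IsDriftPeriodic (Γ : ℝ → UnitTangent) : Prop :=
  ∃ τ : ℂ, τ ≠ 0 ∧ IsTranslationalSymmetry τ ∧
    (fun x : UnitTangent => (x.1 + τ, x.2)) '' Set.range Γ = Set.range Γ

end Trihex

end

/-!
The proof replaces the flow by a rotation of the circle. If a triangle is folded over one of its
sides onto the neighboring hexagon, a trajectory runs along one straight line of the folded plane,
forward in hexagons and backward in triangles. The folded hexagons have their centers at points of
the triangular lattice, and the hexagon in use is always the one whose center is the lattice point
next to the line on a fixed side of it. Therefore the sequence of hexagons is coded by a Sturmian
sequence.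

This is made explicit without the folding. Choose lattice coordinates in which the direction is
`σ (α + (1 - α) ζ)` with `0 ≤ α ≤ 1` and the center of the hexagon is to the left; a reflection of
the tiling arranges the latter. The trajectory crosses the spoke from the center to `1 - ζ` at some
distance `κ` in `[0, 1)` from the center, and in the next hexagon, seen in a frame turned by
`ζ ^ 4`, it crosses the same spoke at the distance `fract (κ + α)` (`IsTrajectory.step`, which
computes three straight segments). With the Sturmian letters
`s k = ⌊κ + (k + 1) α⌋ - ⌊κ + k α⌋`, the center of the `n`-th hexagon is
`∑ k < n, ζ ^ (4 k) (2 - 2 ζ s k)` (`IsTrajectory.exists_times`), and the time between hexagons is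
bounded from above and from below.

* If `α` is rational, the state returns up to a translation of the tiling, and by uniqueness of the
  flow (`IsTrajectory.eq_of_eq_at`) the whole trajectory is invariant up to this translation.
* If `α` is irrational, the centers are unbounded (`hexCenter_unbounded`). Otherwise the interval
  `[1 - α, 1)` would have bounded discrepancy for the rotation by `3 α`, although `α` is not in
  `3 α ℤ + ℤ` (`discrepancy_unbounded`, an instance of Kesten's theorem with an elementary proof).
  Still the centers grow sublinearly (`sturmian_twisted_sum_sublinear`), since the cubic character
  `k ↦ ζ ^ (4 k)` does not correlate with the sequence.

This dichotomy (`IsTrajectory.hasDichotomy`) gives the theorem, as a trajectory that is translated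
by `τ` after the time `P` has the speed `‖τ‖ / P`.
-/

namespace Trihex

/-! ### Irrational rotations and the sums of Sturmian sequences -/

/-- The positive orbit of an irrational rotation is dense modulo `1`, even after any time `m`. -/
theorem exists_nat_mul_sub_int_mem_Ioo {γ : ℝ} (hγ : Irrational γ) (x : ℝ) {ε : ℝ} (hε : 0 < ε)
    (m : ℕ) : ∃ n : ℕ, m ≤ n ∧ ∃ p : ℤ, x < n * γ - p ∧ n * γ - p < x + ε := by
  obtain ⟨N, hN⟩ := exists_nat_one_div_lt hε
  obtain ⟨j, k, hk0, -, hkj⟩ := Real.exists_int_int_abs_mul_sub_le γ (Nat.succ_pos N)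
  set δ : ℝ := k * γ - j with hδ
  have hδε : |δ| < ε := by
    refine lt_of_le_of_lt hkj (lt_of_le_of_lt ?_ hN)
    push_cast
    gcongr
    linarith
  have hδ0 : δ ≠ 0 := by
    intro h
    have h2 := (hγ.intCast_mul hk0.ne').ne_int j
    exact h2 (by linarith)
  have hδp : 0 < |δ| := abs_pos.2 hδ0
  have key : ∀ y : ℝ, ∃ (t : ℕ) (P : ℤ), m ≤ t ∧ y + P < t * |δ| ∧ t * |δ| < y + P + ε := by
    intro y
    obtain ⟨P, hP⟩ := exists_nat_gt (m * |δ| - y)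
    have h1 : 0 ≤ (y + P) / |δ| := div_nonneg (by nlinarith [Nat.cast_nonneg (α := ℝ) m]) hδp.le
    refine ⟨⌊(y + P) / |δ|⌋₊ + 1, P, ?_, ?_, ?_⟩
    · have : m ≤ ⌊(y + P) / |δ|⌋₊ := by
        apply Nat.le_floor
        rw [le_div_iff₀ hδp]
        linarith
      omega
    · have := Nat.lt_floor_add_one ((y + P) / |δ|)
      rw [div_lt_iff₀ hδp] at this
      push_cast
      linarith
    · have := Nat.floor_le h1
      rw [le_div_iff₀ hδp] at this
      push_cast
      linarith
  obtain ⟨k', rfl⟩ : ∃ k' : ℕ, k = k' := ⟨k.toNat, by omega⟩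
  have hk1 : 1 ≤ k' := by omega
  rcases lt_or_gt_of_ne hδ0 with h | h
  · obtain ⟨t, P, hm, h1, h2⟩ := key (-x - ε)
    rw [abs_of_neg h] at h1 h2
    refine ⟨t * k', by nlinarith, t * j - P, ?_, ?_⟩ <;>
    · push_cast at *
      have : (t : ℝ) * k' * γ = t * δ + t * j := by rw [hδ]; ring
      linarith
  · obtain ⟨t, P, hm, h1, h2⟩ := key x
    rw [abs_of_pos h] at h1 h2
    refine ⟨t * k', by nlinarith, t * j + P, ?_, ?_⟩ <;>
    · push_cast at *
      have : (t : ℝ) * k' * γ = t * δ + t * j := by rw [hδ]; ring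
      linarith

/-- The Sturmian sequence of slope `α` and intercept `x`. -/
noncomputable def sturmian (α x : ℝ) (k : ℕ) : ℤ := ⌊x + (k + 1) * α⌋ - ⌊x + k * α⌋

theorem abs_sturmian_le (α x : ℝ) (k : ℕ) : |(sturmian α x k : ℝ)| ≤ |α| + 1 := by
  have h1 := Int.floor_le (x + (k + 1) * α)
  have h2 := Int.lt_floor_add_one (x + (k + 1) * α)
  have h3 := Int.floor_le (x + k * α)
  have h4 := Int.lt_floor_add_one (x + k * α)
  have h5 := le_abs_self α
  have h6 := neg_abs_le α
  unfold sturmian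
  push_cast
  rw [abs_le]
  constructor <;> nlinarith

/-- Returns of the irrational rotation to a small neighborhood of the starting point take long. -/
theorem exists_pos_le_abs_mul_sub_int {α : ℝ} (hα : Irrational α) (R : ℕ) :
    ∃ η : ℝ, 0 < η ∧ ∀ j : ℕ, 1 ≤ j → j < R → ∀ p : ℤ, η ≤ |j * α - p| := by
  induction R with
  | zero => exact ⟨1, one_pos, fun j _ h => by omega⟩
  | succ R ih =>
    obtain ⟨η, h0, h⟩ := ih
    rcases Nat.eq_zero_or_pos R with rfl | hR
    · exact ⟨1, one_pos, fun j _ h => by omega⟩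
    refine ⟨min η |R * α - round (R * α)|, lt_min h0 (abs_pos.2 ?_), fun j h1 h2 p => ?_⟩
    · exact sub_ne_zero.2 ((hα.natCast_mul hR.ne').ne_int _)
    · rcases (Nat.lt_succ_iff_lt_or_eq.1 h2) with h3 | rfl
      · exact (min_le_left _ _).trans (h j h1 h3 p)
      · exact (min_le_right _ _).trans (round_le _ _)

/-- A set of naturals below `n` with gaps at least `R` has at most `n / R + 1` elements. -/
theorem card_le_of_separated {R n : ℕ} (S : Finset ℕ) (hS : ∀ k ∈ S, k < n)
    (hsep : ∀ k ∈ S, ∀ k' ∈ S, k < k' → R ≤ k' - k) (hR : 0 < R) : S.card ≤ n / R + 1 := by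
  rw [← Finset.card_range (n / R + 1)]
  refine Finset.card_le_card_of_injOn (fun k => k / R) ?_ ?_
  · intro k hk
    simp only [Finset.coe_range, Set.mem_Iio]
    exact Nat.lt_succ_of_le (Nat.div_le_div_right (hS k hk).le)
  · intro k hk k' hk' h
    have h1 := Nat.div_add_mod k R
    have h2 := Nat.div_add_mod k' R
    have h3 := Nat.mod_lt k hR
    have h4 := Nat.mod_lt k' hR
    simp only at h
    rw [h] at h1
    rcases lt_trichotomy k k' with h5 | h5 | h5
    · have := hsep k hk k' hk' h5; omega
    · exact h5
    · have := hsep k' hk' k hk h5; omega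

/-- For an irrational slope, the sums of a Sturmian sequence twisted by a cubic character grow
sublinearly. A time `i ≡ 1` modulo `3` at which the rotation by `α` nearly returns changes the
sequence in few places, but it multiplies the twisted sum by a nontrivial cube root of unity. -/
theorem sturmian_twisted_sum_sublinear {α : ℝ} (hα : Irrational α) (x : ℝ) {w : ℂ}
    (hw3 : w ^ 3 = 1) (hw1 : w ≠ 1) {ε : ℝ} (hε : 0 < ε) :
    ∃ C : ℝ, ∀ n : ℕ, ‖∑ k ∈ Finset.range n, w ^ k * (sturmian α x k : ℂ)‖ ≤ ε * n + C := by
  set c : ℝ := ‖w ^ 2 - 1‖ with hc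
  have hc0 : 0 < c := by
    rw [hc, norm_pos_iff, sub_ne_zero]
    intro h
    exact hw1 (by rw [← hw3, pow_succ, h, one_mul])
  have hwn : ‖w‖ = 1 := by
    have : ‖w‖ ^ 3 = 1 := by rw [← norm_pow, hw3, norm_one]
    exact (pow_eq_one_iff_of_nonneg (norm_nonneg _) (by norm_num)).1 this
  obtain ⟨R, hR⟩ := exists_nat_gt (2 / (ε * c))
  have hRpos : (0 : ℝ) < R := lt_trans (by positivity) hR
  have hR0 : 0 < R := by exact_mod_cast hRpos
  have hR' : 2 / R ≤ ε * c := by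
    rw [div_lt_iff₀ (by positivity)] at hR
    rw [div_le_iff₀ hRpos]
    linarith
  obtain ⟨η, hη, hsep⟩ := exists_pos_le_abs_mul_sub_int hα R
  have h3 : Irrational (3 * α) := by exact_mod_cast hα.natCast_mul (m := 3) (by norm_num)
  obtain ⟨l, -, P, hP1, hP2⟩ := exists_nat_mul_sub_int_mem_Ioo h3 (-α) (lt_min hη one_pos) 0
  set i : ℕ := 3 * l + 1 with hi
  set δ : ℝ := i * α - P with hδ
  have hδ0 : 0 < δ := by rw [hδ, hi]; push_cast; linarith
  have hδη : δ < min η 1 := by rw [hδ, hi]; push_cast; linarith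
  have hδ1 : δ < 1 := hδη.trans_le (min_le_right _ _)
  replace hδη : δ < η := hδη.trans_le (min_le_left _ _)
  set e : ℕ → ℤ := fun k => ⌊x + k * α + δ⌋ - ⌊x + k * α⌋ with he
  set W : ℕ → ℂ := fun n => ∑ k ∈ Finset.range n, w ^ k * (sturmian α x k : ℂ) with hW
  set B : ℝ := |α| + 1 with hB
  have hterm : ∀ k, ‖w ^ k * (sturmian α x k : ℂ)‖ ≤ B := by
    intro k
    rw [norm_mul, norm_pow, hwn, one_pow, one_mul, Complex.norm_intCast]
    exact abs_sturmian_le α x k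
  have hshift : ∀ k, sturmian α x (k + i) = sturmian α x k + (e (k + 1) - e k) := by
    intro k
    have h1 : x + ((k + i : ℕ) + 1) * α = x + ((k + 1 : ℕ) : ℝ) * α + δ + P := by
      rw [hδ]; push_cast; ring
    have h2 : x + ((k + i : ℕ) : ℝ) * α = x + (k : ℝ) * α + δ + P := by
      rw [hδ]; push_cast; ring
    simp only [sturmian, he, h1, h2, Int.floor_add_intCast]
    push_cast
    ring
  -- `e k` is `0` or `1`, and it is `1` only just below an integer
  have he01 : ∀ k, 0 ≤ e k ∧ e k ≤ 1 ∧
      (e k ≠ 0 → ∃ a : ℤ, x + k * α < a ∧ (a : ℝ) ≤ x + k * α + δ) := by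
    intro k
    have h1 : ⌊x + k * α⌋ ≤ ⌊x + k * α + δ⌋ := Int.floor_le_floor (by linarith)
    have h2 : ⌊x + k * α + δ⌋ ≤ ⌊x + k * α⌋ + 1 := by
      rw [← Int.floor_add_one]
      exact Int.floor_le_floor (by linarith)
    simp only [he]
    refine ⟨by omega, by omega, fun h => ⟨⌊x + k * α + δ⌋, ?_, Int.floor_le _⟩⟩
    rw [← Int.floor_lt]
    omega
  have hcount : ∀ n : ℕ, ∑ k ∈ Finset.range n, (e k : ℝ) ≤ n / R + 1 := by
    intro n
    have hcard := card_le_of_separated (R := R) (n := n)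
      ((Finset.range n).filter fun k => e k ≠ 0) (fun k hk => by simp at hk; exact hk.1)
      (by
        intro k hk k' hk' hkk'
        simp only [Finset.mem_filter, Finset.mem_range] at hk hk'
        obtain ⟨a, ha1, ha2⟩ := (he01 k).2.2 hk.2
        obtain ⟨a', ha1', ha2'⟩ := (he01 k').2.2 hk'.2
        by_contra hlt
        have := hsep (k' - k) (by omega) (by omega) (a' - a)
        rw [Nat.cast_sub hkk'.le] at this
        push_cast at this
        have h2 : |((k' : ℝ) - k) * α - (a' - a)| < δ := by
          rw [abs_lt]; constructor <;> nlinarith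
        linarith) hR0
    calc ∑ k ∈ Finset.range n, (e k : ℝ)
        ≤ ∑ k ∈ Finset.range n, (if e k ≠ 0 then (1 : ℝ) else 0) := by
          refine Finset.sum_le_sum fun k _ => ?_
          split_ifs with h
          · exact_mod_cast (he01 k).2.1
          · push Not at h
            simp [h]
      _ = (((Finset.range n).filter fun k => e k ≠ 0).card : ℝ) := by
          rw [Finset.sum_boole]
      _ ≤ ((n / R + 1 : ℕ) : ℝ) := by exact_mod_cast hcard
      _ ≤ n / R + 1 := by
          push_cast
          gcongr
          exact Nat.cast_div_le
  have hdiff : ∀ n m : ℕ, ‖W (n + m) - W n‖ ≤ m * B := by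
    intro n m
    simp only [hW, Finset.sum_range_add, add_sub_cancel_left]
    refine (norm_sum_le _ _).trans ?_
    refine (Finset.sum_le_sum fun k _ => hterm (n + k)).trans ?_
    simp
  have hident : ∀ n : ℕ, (w ^ 2 - 1) * W n =
      ∑ k ∈ Finset.range n, w ^ k * ((e (k + 1) : ℂ) - e k)
        - w ^ 2 * (W (n + i) - W n) + w ^ 2 * W i := by
    intro n
    have h1 : W (n + i) = W i + w ^ i * ∑ k ∈ Finset.range n, w ^ k * (sturmian α x (k + i) : ℂ) := by
      simp only [hW, add_comm n i, Finset.sum_range_add, Finset.mul_sum]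
      congr 1
      refine Finset.sum_congr rfl fun k _ => ?_
      rw [add_comm k i]
      ring
    have h2 : ∑ k ∈ Finset.range n, w ^ k * (sturmian α x (k + i) : ℂ) =
        W n + ∑ k ∈ Finset.range n, w ^ k * ((e (k + 1) : ℂ) - e k) := by
      simp only [hW, ← Finset.sum_add_distrib]
      refine Finset.sum_congr rfl fun k _ => ?_
      rw [hshift]
      push_cast
      ring
    have h4 : w ^ i = w := by rw [hi, pow_succ, pow_mul, hw3, one_pow, one_mul]
    rw [h2, h4] at h1
    rw [h1]
    linear_combination (W n + ∑ k ∈ Finset.range n, w ^ k * ((e (k + 1) : ℂ) - e k)) * hw3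
  have hbound : ∀ n : ℕ, c * ‖W n‖ ≤ 2 / R * n + (2 / R + 2 + i * B + ‖W i‖) := by
    intro n
    have h1 : ‖∑ k ∈ Finset.range n, w ^ k * ((e (k + 1) : ℂ) - e k)‖ ≤
        2 * ((n + 1 : ℕ) / R + 1) := by
      have hle : ∀ k ∈ Finset.range n, ‖w ^ k * ((e (k + 1) : ℂ) - e k)‖ ≤ e (k + 1) + e k := by
        intro k _
        rw [norm_mul, norm_pow, hwn, one_pow, one_mul]
        refine (norm_sub_le _ _).trans ?_
        rw [Complex.norm_intCast, Complex.norm_intCast, abs_of_nonneg, abs_of_nonneg] <;>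
          exact_mod_cast (he01 _).1
      refine ((norm_sum_le _ _).trans (Finset.sum_le_sum hle)).trans ?_
      rw [Finset.sum_add_distrib]
      have h2 := hcount (n + 1)
      have h3 := h2
      rw [Finset.sum_range_succ'] at h2
      rw [Finset.sum_range_succ] at h3
      have h4 : (0 : ℝ) ≤ e 0 := by exact_mod_cast (he01 0).1
      have h5 : (0 : ℝ) ≤ e n := by exact_mod_cast (he01 n).1
      linarith
    have h2 : ‖w ^ 2 * (W (n + i) - W n)‖ ≤ i * B := by
      rw [norm_mul, norm_pow, hwn, one_pow, one_mul]
      exact hdiff n i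
    have h3 : ‖w ^ 2 * W i‖ = ‖W i‖ := by
      rw [norm_mul, norm_pow, hwn, one_pow, one_mul]
    rw [hc, ← norm_mul, hident n]
    refine (norm_add_le _ _).trans ?_
    have h4 := norm_sub_le (∑ k ∈ Finset.range n, w ^ k * ((e (k + 1) : ℂ) - e k))
      (w ^ 2 * (W (n + i) - W n))
    have h5 : (2 : ℝ) * ((n + 1 : ℕ) / R + 1) = 2 / R * n + (2 / R + 2) := by
      push_cast; ring
    linarith
  refine ⟨(2 / R + 2 + i * B + ‖W i‖) / c, fun n => ?_⟩
  have h1 : 2 / R * n ≤ ε * c * n := by gcongr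
  have h2 := hbound n
  change ‖W n‖ ≤ _
  rw [← mul_le_mul_iff_right₀ hc0, mul_add, mul_div_cancel₀ _ hc0.ne']
  linarith

/-- The difference of two consecutive Sturmian letters with intercept `x`. -/
noncomputable def letterDiff (α x : ℝ) : ℤ := 2 * ⌊x + α⌋ - ⌊x⌋ - ⌊x + 2 * α⌋

/-- The sum `∑ (s (3 i) - s (3 i + 1))` over `i < N`, for the Sturmian sequence `s` with slope `α`
and intercept `x`; it is a cocycle over the rotation by `3 α`. -/
noncomputable def discrepancy (α : ℝ) (N : ℕ) (x : ℝ) : ℤ :=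
  ∑ i ∈ Finset.range N, letterDiff α (x + i * (3 * α))

theorem letterDiff_sub_int (α x : ℝ) (p : ℤ) : letterDiff α (x - p) = letterDiff α x := by
  have h1 : x - p + α = x + α - p := by ring
  have h2 : x - p + 2 * α = x + 2 * α - p := by ring
  simp only [letterDiff, h1, h2, Int.floor_sub_intCast]
  ring

theorem discrepancy_sub_int (α : ℝ) (N : ℕ) (x : ℝ) (p : ℤ) :
    discrepancy α N (x - p) = discrepancy α N x := by
  refine Finset.sum_congr rfl fun i _ => ?_
  rw [← letterDiff_sub_int α (x + i * (3 * α)) p]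
  congr 1
  ring

theorem discrepancy_add (α : ℝ) (N M : ℕ) (x : ℝ) :
    discrepancy α (N + M) x = discrepancy α N x + discrepancy α M (x + N * (3 * α)) := by
  simp only [discrepancy, Finset.sum_range_add]
  congr 1
  refine Finset.sum_congr rfl fun i _ => ?_
  congr 1
  push_cast
  ring

theorem eventually_floor_add_eq_right (x c : ℝ) : ∀ᶠ y in 𝓝[≥] x, ⌊y + c⌋ = ⌊x + c⌋ := by
  have h : Tendsto (fun y => y + c) (𝓝[≥] x) (𝓝[≥] (x + c)) :=
    tendsto_nhdsWithin_of_tendsto_nhds_of_eventually_within _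
      ((continuous_id.add continuous_const).continuousAt.mono_left nhdsWithin_le_nhds)
      (by filter_upwards [self_mem_nhdsWithin] with y hy; simpa using hy)
  have := (tendsto_floor_right_pure_floor (x + c)).comp h
  exact tendsto_pure.1 this

theorem eventually_floor_add_eq_left {x c : ℝ} (hx : ∀ p : ℤ, x + c ≠ p) :
    ∀ᶠ y in 𝓝[<] x, ⌊y + c⌋ = ⌊x + c⌋ := by
  have h1 : (⌊x + c⌋ : ℝ) < x + c := lt_of_le_of_ne (Int.floor_le _) (hx _).symm
  have : Set.Ioo (⌊x + c⌋ - c) x ∈ 𝓝[<] x := Ioo_mem_nhdsLT (by linarith)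
  filter_upwards [this] with y hy
  rw [Int.floor_eq_iff]
  constructor
  · linarith [hy.1]
  · linarith [hy.2, Int.lt_floor_add_one (x + c)]

theorem eventually_floor_add_eq_sub_one {x c : ℝ} (p : ℤ) (hx : x + c = p) :
    ∀ᶠ y in 𝓝[<] x, ⌊y + c⌋ = ⌊x + c⌋ - 1 := by
  have : Set.Ioo (x - 1) x ∈ 𝓝[<] x := Ioo_mem_nhdsLT (by linarith)
  filter_upwards [this] with y hy
  rw [hx, Int.floor_intCast, Int.floor_eq_iff]
  push_cast
  constructor <;> linarith [hy.1, hy.2]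

theorem discrepancy_eventually_eq_right (α : ℝ) (N : ℕ) (x : ℝ) :
    ∀ᶠ y in 𝓝[≥] x, discrepancy α N y = discrepancy α N x := by
  have h : ∀ i ∈ Finset.range N, ∀ᶠ y in 𝓝[≥] x,
      letterDiff α (y + i * (3 * α)) = letterDiff α (x + i * (3 * α)) := by
    intro i _
    filter_upwards [eventually_floor_add_eq_right x (i * (3 * α)),
      eventually_floor_add_eq_right x (i * (3 * α) + α),
      eventually_floor_add_eq_right x (i * (3 * α) + 2 * α)] with y h1 h2 h3
    simp only [letterDiff, add_assoc] at *
    rw [h1, h2, h3]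
  filter_upwards [(Filter.eventually_all_finset _).2 h] with y hy
  exact Finset.sum_congr rfl hy

/-- Of the discontinuities of the summands, only one is at `x = p - (3 i + 1) α`, as `α` is
irrational. -/
theorem discrepancy_jump {α : ℝ} (hα : Irrational α) {N i : ℕ} (hi : i < N) {x : ℝ} {p : ℤ}
    (hx : x + i * (3 * α) + α = p) :
    ∀ᶠ y in 𝓝[<] x, discrepancy α N y = discrepancy α N x - 2 := by
  have hne : ∀ (m : ℤ), m ≠ 0 → ∀ c : ℝ, c = p + m * α → ∀ q : ℤ, c ≠ q := by
    intro m hm c hc q hq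
    apply (hα.intCast_mul hm).ne_int (q - p)
    push_cast
    linarith
  have h : ∀ j ∈ Finset.range N, ∀ᶠ y in 𝓝[<] x,
      letterDiff α (y + j * (3 * α)) =
        letterDiff α (x + j * (3 * α)) + if j = i then -2 else 0 := by
    intro j _
    have e0 : ∀ᶠ y in 𝓝[<] x, ⌊y + j * (3 * α)⌋ = ⌊x + j * (3 * α)⌋ :=
      eventually_floor_add_eq_left (hne (3 * (j - i) - 1) (by omega) _ (by push_cast; linarith))
    have e2 : ∀ᶠ y in 𝓝[<] x, ⌊y + (j * (3 * α) + 2 * α)⌋ = ⌊x + (j * (3 * α) + 2 * α)⌋ :=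
      eventually_floor_add_eq_left (hne (3 * (j - i) + 1) (by omega) _ (by push_cast; linarith))
    by_cases hj : j = i
    · subst hj
      filter_upwards [e0, e2, eventually_floor_add_eq_sub_one (x := x) (c := j * (3 * α) + α) p
        (by linarith)] with y h0 h2 h1
      simp only [letterDiff, add_assoc] at *
      rw [h0, h1, h2]
      simp
      ring
    · have e1 : ∀ᶠ y in 𝓝[<] x, ⌊y + (j * (3 * α) + α)⌋ = ⌊x + (j * (3 * α) + α)⌋ :=
        eventually_floor_add_eq_left (hne (3 * (j - i)) (by omega) _ (by push_cast; linarith))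
      filter_upwards [e0, e1, e2] with y h0 h1 h2
      simp only [letterDiff, add_assoc] at *
      rw [h0, h1, h2]
      simp [hj]
  filter_upwards [(Filter.eventually_all_finset _).2 h] with y hy
  rw [discrepancy, Finset.sum_congr rfl hy, Finset.sum_add_distrib, Finset.sum_ite_eq',
    if_pos (Finset.mem_range.2 hi), discrepancy]
  ring

theorem exists_Ico_of_eventually_right {P : ℝ → Prop} {x : ℝ} (h : ∀ᶠ y in 𝓝[≥] x, P y) :
    ∃ ε > 0, ∀ y, x ≤ y → y < x + ε → P y := by
  obtain ⟨u, hu, hP⟩ := (mem_nhdsGE_iff_exists_Ico_subset).1 h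
  exact ⟨u - x, sub_pos.2 hu, fun y h1 h2 => hP ⟨h1, by linarith⟩⟩

/-- By density of the orbit of `x₀` and continuity from the right, a bound along one orbit gives a
bound at all points. -/
theorem discrepancy_bounded_everywhere {α : ℝ} (hα : Irrational α) {x₀ : ℝ} {C : ℤ}
    (hC : ∀ N, |discrepancy α N x₀| ≤ C) (N : ℕ) (x : ℝ) : |discrepancy α N x| ≤ 2 * C := by
  have h3 : Irrational (3 * α) := by exact_mod_cast hα.natCast_mul (m := 3) (by norm_num)
  obtain ⟨ε, hε, h⟩ := exists_Ico_of_eventually_right (discrepancy_eventually_eq_right α N x)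
  obtain ⟨M, -, p, h1, h2⟩ := exists_nat_mul_sub_int_mem_Ioo h3 (x - x₀) hε 0
  have h4 := h (x₀ + M * (3 * α) - p) (by linarith) (by linarith)
  rw [discrepancy_sub_int] at h4
  have h5 := discrepancy_add α M N x₀
  have h6 := hC M
  have h7 := hC (M + N)
  rw [abs_le] at *
  constructor <;> omega

/-- The interval `[1 - α, 1)` does not have bounded discrepancy for the rotation by `3 α`, in a
form for the differences of letters. If the sums `F n` were bounded, a maximum of `F` would give
an interval on which all `F n` are at most `0`, and a minimum over that interval would give a
smaller one such that `F n = 0` at each return to it. The sums `F n` have jumps of size `2` that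
no other jump cancels, and some of them fall into this interval at nearly periodic times `n`. -/
theorem discrepancy_unbounded {α : ℝ} (hα : Irrational α) (x₀ : ℝ) (C : ℤ) :
    ∃ N, C < |discrepancy α N x₀| := by
  by_contra! hC
  have hb := discrepancy_bounded_everywhere hα hC
  have h3 : Irrational (3 * α) := by exact_mod_cast hα.natCast_mul (m := 3) (by norm_num)
  obtain ⟨_, ⟨q, x, rfl⟩, hmax⟩ := Int.exists_greatest_of_bdd
    (P := fun m => ∃ (N : ℕ) (x : ℝ), discrepancy α N x = m)
    ⟨2 * C, by rintro _ ⟨N, x, rfl⟩; exact (abs_le.1 (hb N x)).2⟩ ⟨_, 0, 0, rfl⟩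
  obtain ⟨ε, hε, hx⟩ := exists_Ico_of_eventually_right (discrepancy_eventually_eq_right α q x)
  have hneg : ∀ y, x + q * (3 * α) ≤ y → y < x + q * (3 * α) + ε → ∀ r, discrepancy α r y ≤ 0 := by
    intro y h1 h2 r
    have h4 := hx (y - q * (3 * α)) (by linarith) (by linarith)
    have h5 := discrepancy_add α q r (y - q * (3 * α))
    have h6 := hmax _ ⟨q + r, y - q * (3 * α), rfl⟩
    rw [sub_add_cancel] at h5
    omega
  obtain ⟨_, ⟨r, z, hz1, hz2, rfl⟩, hmin⟩ := Int.exists_least_of_bdd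
    (P := fun m => ∃ (N : ℕ) (y : ℝ), x + q * (3 * α) ≤ y ∧ y < x + q * (3 * α) + ε ∧
      discrepancy α N y = m)
    ⟨-(2 * C), by rintro _ ⟨N, y, -, -, rfl⟩; exact (abs_le.1 (hb N y)).1⟩
    ⟨_, 0, x + q * (3 * α), le_rfl, by linarith, rfl⟩
  obtain ⟨η₀, hη₀, hz⟩ := exists_Ico_of_eventually_right (discrepancy_eventually_eq_right α r z)
  obtain ⟨η, hη, hη1, hη2⟩ : ∃ η > 0, η ≤ η₀ ∧ z + η ≤ x + q * (3 * α) + ε :=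
    ⟨min η₀ (x + q * (3 * α) + ε - z), lt_min hη₀ (by linarith), min_le_left _ _,
      by linarith [min_le_right η₀ (x + q * (3 * α) + ε - z)]⟩
  have hret : ∀ y, z ≤ y → y < z + η → ∀ (n : ℕ) (p : ℤ), z ≤ y + n * (3 * α) - p →
      y + n * (3 * α) - p < z + η → discrepancy α n y = 0 := by
    intro y h1 h2 n p h4 h5
    have h6 := hneg y (by linarith) (by linarith) n
    have h7 := hmin _ ⟨n + r, y, by linarith, by linarith, rfl⟩
    have h8 := hz _ h4 (by linarith)
    rw [discrepancy_sub_int] at h8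
    rw [discrepancy_add, h8] at h7
    omega
  have h3' : Irrational (-(3 * α)) := h3.neg
  obtain ⟨i, -, p, hi1, hi2⟩ := exists_nat_mul_sub_int_mem_Ioo h3' (z + α) (half_pos hη) 0
  obtain ⟨n, hn, p', hn1, hn2⟩ := exists_nat_mul_sub_int_mem_Ioo h3 0 (half_pos hη) (i + 1)
  set d : ℝ := i * (-(3 * α)) - p - α with hd
  have hj := discrepancy_jump hα (show i < n by omega) (x := d) (p := -p)
    (by rw [hd]; push_cast; ring)
  have hnear : Set.Ioo z d ∈ 𝓝[<] d := Ioo_mem_nhdsLT (by linarith)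
  obtain ⟨y, hy, hyd⟩ := (hj.and hnear).exists
  have e1 := hret d (by linarith) (by linarith) n p' (by linarith) (by linarith)
  have e2 := hret y (by linarith [hyd.1]) (by linarith [hyd.2]) n p' (by linarith [hyd.1])
    (by linarith [hyd.2])
  omega

/-! ### Lattice coordinates and the lines of the tiling -/

/-- The point with coordinates `(a, b)` in the basis `1`, `ζ` of the plane. -/
noncomputable def pt (a b : ℝ) : ℂ := a + b * zeta

theorem zeta_sq : zeta ^ 2 = zeta - 1 := by
  have h : Real.sqrt 3 * Real.sqrt 3 = 3 := Real.mul_self_sqrt (by norm_num)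
  apply Complex.ext <;> simp [zeta, pow_two] <;> nlinarith

theorem zeta_cube : zeta ^ 3 = -1 := by
  linear_combination (zeta + 1) * zeta_sq

theorem zeta_pow_six : zeta ^ 6 = 1 := by
  linear_combination (zeta ^ 3 - 1) * zeta_cube

theorem conj_zeta : conj zeta = 1 - zeta := by
  apply Complex.ext <;> simp [zeta]; norm_num

theorem zeta_ne_zero : zeta ≠ 0 := by
  intro h
  simpa [h] using zeta_cube

theorem norm_zeta : ‖zeta‖ = 1 := by
  have h : ‖zeta‖ ^ 6 = 1 := by rw [← norm_pow, zeta_pow_six, norm_one]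
  exact (pow_eq_one_iff_of_nonneg (norm_nonneg _) (by norm_num)).1 h

theorem pt_re (a b : ℝ) : (pt a b).re = a + b / 2 := by simp [pt, zeta]; ring

theorem pt_im (a b : ℝ) : (pt a b).im = b * (Real.sqrt 3 / 2) := by simp [pt, zeta]

theorem pt_inj {a b c d : ℝ} : pt a b = pt c d ↔ a = c ∧ b = d := by
  refine ⟨fun h => ?_, fun h => by rw [h.1, h.2]⟩
  have h1 := congrArg Complex.re h
  have h2 := congrArg Complex.im h
  rw [pt_re, pt_re] at h1
  rw [pt_im, pt_im] at h2
  have h3 : b = d := mul_right_cancel₀ (by positivity) h2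
  exact ⟨by linarith, h3⟩

theorem exists_eq_pt (z : ℂ) : ∃ a b : ℝ, z = pt a b := by
  have h : Real.sqrt 3 ≠ 0 := by positivity
  refine ⟨z.re - z.im / Real.sqrt 3, 2 * z.im / Real.sqrt 3, Complex.ext ?_ ?_⟩
  · rw [pt_re]; ring
  · rw [pt_im]; field_simp

theorem pt_add (a b c d : ℝ) : pt a b + pt c d = pt (a + c) (b + d) := by
  simp only [pt]; push_cast; ring

theorem real_mul_pt (s a b : ℝ) : (s : ℂ) * pt a b = pt (s * a) (s * b) := by
  simp only [pt]; push_cast; ring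

theorem zeta_mul_pt (a b : ℝ) : zeta * pt a b = pt (-b) (a + b) := by
  simp only [pt]; push_cast
  linear_combination (b : ℂ) * zeta_sq

theorem zeta_mul_conj_pt (a b : ℝ) : zeta * conj (pt a b) = pt b a := by
  simp only [pt, map_add, map_mul, Complex.conj_ofReal, conj_zeta]
  linear_combination -(b : ℂ) * zeta_sq

theorem norm_pt_sq (a b : ℝ) : ‖pt a b‖ ^ 2 = a ^ 2 + a * b + b ^ 2 := by
  have h : Real.sqrt 3 * Real.sqrt 3 = 3 := Real.mul_self_sqrt (by norm_num)
  rw [← Complex.normSq_eq_norm_sq, Complex.normSq_apply, pt_re, pt_im]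
  linear_combination b ^ 2 / 4 * h

theorem mem_eisenstein_iff (z : ℂ) : z ∈ eisenstein ↔ ∃ m n : ℤ, z = pt m n := by
  have e2 : (⟨-1 / 2, Real.sqrt 3 / 2⟩ : ℂ) = pt (-1) 1 := by
    apply Complex.ext
    · rw [pt_re]; norm_num
    · rw [pt_im]; ring
  have e3 : (⟨-1 / 2, -(Real.sqrt 3 / 2)⟩ : ℂ) = pt 0 (-1) := by
    apply Complex.ext
    · rw [pt_re]; norm_num
    · rw [pt_im]; ring
  constructor
  · intro h
    induction h using AddSubgroup.closure_induction with
    | mem x hx =>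
      rcases hx with rfl | rfl | rfl
      · exact ⟨1, 0, by simp [pt]⟩
      · exact ⟨-1, 1, by rw [e2]; simp⟩
      · exact ⟨0, -1, by rw [e3]; simp⟩
    | zero => exact ⟨0, 0, by simp [pt]⟩
    | add x y _ _ hx hy =>
      obtain ⟨m, n, rfl⟩ := hx
      obtain ⟨m', n', rfl⟩ := hy
      exact ⟨m + m', n + n', by rw [pt_add]; push_cast; rfl⟩
    | neg x _ hx =>
      obtain ⟨m, n, rfl⟩ := hx
      exact ⟨-m, -n, by simp only [pt]; push_cast; ring⟩
  · rintro ⟨m, n, rfl⟩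
    have h1 : (1 : ℂ) ∈ eisenstein := AddSubgroup.subset_closure (by simp)
    have h3 : pt 0 (-1) ∈ eisenstein := e3 ▸ AddSubgroup.subset_closure (by simp)
    have : pt m n = m • (1 : ℂ) + (-n) • pt 0 (-1) := by simp [pt]
    rw [this]
    exact add_mem (zsmul_mem h1 _) (zsmul_mem h3 _)

theorem isHexCenter_iff (c : ℂ) : IsHexCenter c ↔ ∃ m n : ℤ, c = pt (2 * m) (2 * n) := by
  constructor
  · rintro ⟨z, hz, rfl⟩
    obtain ⟨m, n, rfl⟩ := (mem_eisenstein_iff z).1 hz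
    exact ⟨m, n, by simp only [pt]; push_cast; ring⟩
  · rintro ⟨m, n, rfl⟩
    exact ⟨pt m n, (mem_eisenstein_iff _).2 ⟨m, n, rfl⟩, by simp only [pt]; push_cast; ring⟩

theorem isHexCenter_zero : IsHexCenter 0 :=
  (isHexCenter_iff 0).2 ⟨0, 0, by simp [pt]⟩

theorem IsHexCenter.add {c d : ℂ} (hc : IsHexCenter c) (hd : IsHexCenter d) :
    IsHexCenter (c + d) := by
  obtain ⟨z, hz, rfl⟩ := hc
  obtain ⟨w, hw, rfl⟩ := hd
  exact ⟨z + w, add_mem hz hw, by ring⟩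

theorem IsHexCenter.neg {c : ℂ} (hc : IsHexCenter c) : IsHexCenter (-c) := by
  obtain ⟨z, hz, rfl⟩ := hc
  exact ⟨-z, neg_mem hz, by ring⟩

theorem IsHexCenter.zeta_mul {c : ℂ} (hc : IsHexCenter c) : IsHexCenter (zeta * c) := by
  obtain ⟨m, n, rfl⟩ := (isHexCenter_iff c).1 hc
  refine (isHexCenter_iff _).2 ⟨-n, m + n, ?_⟩
  rw [zeta_mul_pt]
  push_cast
  congr 1 <;> ring

theorem IsHexCenter.zeta_pow_mul {c : ℂ} (hc : IsHexCenter c) (k : ℕ) :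
    IsHexCenter (zeta ^ k * c) := by
  induction k with
  | zero => simpa using hc
  | succ k ih => rw [pow_succ', mul_assoc]; exact ih.zeta_mul

theorem IsHexCenter.zeta_mul_conj {c : ℂ} (hc : IsHexCenter c) :
    IsHexCenter (zeta * conj c) := by
  obtain ⟨m, n, rfl⟩ := (isHexCenter_iff c).1 hc
  exact (isHexCenter_iff _).2 ⟨n, m, zeta_mul_conj_pt _ _⟩

/-- The six sides of the hexagon at the origin, in lattice coordinates. -/
theorem zeta_pow_cases (k : ℕ) :
    (zeta ^ k = pt 1 0 ∧ zeta ^ (k + 1) = pt 0 1) ∨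
    (zeta ^ k = pt 0 1 ∧ zeta ^ (k + 1) = pt (-1) 1) ∨
    (zeta ^ k = pt (-1) 1 ∧ zeta ^ (k + 1) = pt (-1) 0) ∨
    (zeta ^ k = pt (-1) 0 ∧ zeta ^ (k + 1) = pt 0 (-1)) ∨
    (zeta ^ k = pt 0 (-1) ∧ zeta ^ (k + 1) = pt 1 (-1)) ∨
    (zeta ^ k = pt 1 (-1) ∧ zeta ^ (k + 1) = pt 1 0) := by
  induction k with
  | zero => left; simp [pt]
  | succ k ih =>
    have h : ∀ a b, zeta ^ (k + 1) = pt a b → zeta ^ (k + 1 + 1) = pt (-b) (a + b) := by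
      intro a b hab
      rw [pow_succ', hab, zeta_mul_pt]
    rcases ih with ⟨-, h2⟩ | ⟨-, h2⟩ | ⟨-, h2⟩ | ⟨-, h2⟩ | ⟨-, h2⟩ | ⟨-, h2⟩ <;>
    · have := h _ _ h2
      norm_num at this
      simp [h2, this, pt_inj]

theorem zeta_pow_values : zeta ^ 0 = pt 1 0 ∧ zeta ^ 1 = pt 0 1 ∧ zeta ^ 2 = pt (-1) 1 ∧
    zeta ^ 3 = pt (-1) 0 ∧ zeta ^ 4 = pt 0 (-1) ∧ zeta ^ 5 = pt 1 (-1) ∧ zeta ^ 6 = pt 1 0 := by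
  simp only [pt]
  push_cast
  refine ⟨by ring, by ring, by linear_combination zeta_sq, by linear_combination zeta_cube,
    by linear_combination zeta * zeta_cube, ?_, by linear_combination zeta_pow_six⟩
  linear_combination zeta ^ 2 * zeta_cube - zeta_sq

/-- The two orientations of the side of the hexagon with center `pt (2 m) (2 n)`. -/
theorem isEdge_of_hexagon {m n : ℤ} {a b a' b' : ℝ} {k : ℕ}
    (h : zeta ^ k = pt (a - 2 * m) (b - 2 * n) ∧ zeta ^ (k + 1) = pt (a' - 2 * m) (b' - 2 * n)) :
    IsEdge (pt a b) (pt a' b') ∧ IsEdge (pt a' b') (pt a b) := by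
  have hc : IsHexCenter (pt (2 * m) (2 * n)) := (isHexCenter_iff _).2 ⟨m, n, rfl⟩
  have h1 : pt a b = pt (2 * m) (2 * n) + zeta ^ k := by rw [h.1, pt_add]; congr 1 <;> ring
  have h2 : pt a' b' = pt (2 * m) (2 * n) + zeta ^ (k + 1) := by
    rw [h.2, pt_add]; congr 1 <;> ring
  exact ⟨⟨_, hc, k, Or.inl ⟨h1, h2⟩⟩, ⟨_, hc, k, Or.inr ⟨h2, h1⟩⟩⟩

theorem isEdge_fst_odd (m n : ℤ) : IsEdge (pt (2 * m + 1) n) (pt (2 * m + 1) (n + 1)) := by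
  obtain ⟨-, -, h2, h3, -, h5, h6⟩ := zeta_pow_values
  rcases Int.even_or_odd' n with ⟨j, rfl | rfl⟩
  · refine (isEdge_of_hexagon (m := m + 1) (n := j) (k := 2) ⟨h2.trans ?_, h3.trans ?_⟩).2 <;>
    · rw [pt_inj]; push_cast; constructor <;> ring
  · refine (isEdge_of_hexagon (m := m) (n := j + 1) (k := 5) ⟨h5.trans ?_, h6.trans ?_⟩).1 <;>
    · rw [pt_inj]; push_cast; constructor <;> ring

theorem isEdge_snd_odd (m n : ℤ) : IsEdge (pt n (2 * m + 1)) (pt (n + 1) (2 * m + 1)) := by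
  obtain ⟨-, h1, h2, -, h4, h5, -⟩ := zeta_pow_values
  rcases Int.even_or_odd' n with ⟨j, rfl | rfl⟩
  · refine (isEdge_of_hexagon (m := j) (n := m + 1) (k := 4) ⟨h4.trans ?_, h5.trans ?_⟩).1 <;>
    · rw [pt_inj]; push_cast; constructor <;> ring
  · refine (isEdge_of_hexagon (m := j + 1) (n := m) (k := 1) ⟨h1.trans ?_, h2.trans ?_⟩).2 <;>
    · rw [pt_inj]; push_cast; constructor <;> ring

theorem isEdge_sum_odd (m n : ℤ) :
    IsEdge (pt n (2 * m + 1 - n)) (pt (n - 1) (2 * m + 2 - n)) := by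
  obtain ⟨h0, h1, -, h3, h4, -, -⟩ := zeta_pow_values
  rcases Int.even_or_odd' n with ⟨j, rfl | rfl⟩
  · refine (isEdge_of_hexagon (m := j) (n := m + 1 - j) (k := 3) ⟨h3.trans ?_, h4.trans ?_⟩).2 <;>
    · rw [pt_inj]; push_cast; constructor <;> ring
  · refine (isEdge_of_hexagon (m := j) (n := m - j) (k := 0) ⟨h0.trans ?_, h1.trans ?_⟩).1 <;>
    · rw [pt_inj]; push_cast; constructor <;> ring

theorem isVertex_iff_exists_isEdge (p : ℂ) : IsVertex p ↔ ∃ b, IsEdge p b := by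
  constructor
  · rintro ⟨c, hc, k, rfl⟩
    exact ⟨_, c, hc, k, Or.inl ⟨rfl, rfl⟩⟩
  · rintro ⟨b, c, hc, k, ⟨rfl, -⟩ | ⟨rfl, -⟩⟩
    · exact ⟨c, hc, k, rfl⟩
    · exact ⟨c, hc, k + 1, rfl⟩

theorem isVertex_fst_odd (m n : ℤ) : IsVertex (pt (2 * m + 1) n) :=
  (isVertex_iff_exists_isEdge _).2 ⟨_, isEdge_fst_odd m n⟩

theorem isVertex_snd_odd (m n : ℤ) : IsVertex (pt n (2 * m + 1)) :=
  (isVertex_iff_exists_isEdge _).2 ⟨_, isEdge_snd_odd m n⟩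

theorem isVertex_sum_odd (m n : ℤ) : IsVertex (pt n (2 * m + 1 - n)) :=
  (isVertex_iff_exists_isEdge _).2 ⟨_, isEdge_sum_odd m n⟩

theorem mem_openSegment_of_fract {a b : ℂ} (t : ℝ) (h0 : 0 < t) (h1 : t < 1) :
    a + t * (b - a) ∈ openSegment ℝ a b :=
  ⟨1 - t, t, by linarith, h0, by ring, by simp; ring⟩

theorem fract_pos_of_ne_int {b : ℝ} (h : ∀ n : ℤ, b ≠ n) : 0 < Int.fract b :=
  lt_of_le_of_ne (Int.fract_nonneg b) fun h0 => h ⌊b⌋ (by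
    rw [← sub_eq_zero]; exact h0.symm)

theorem exists_edge_of_fst_odd {m : ℤ} {a b : ℝ} (ha : a = 2 * m + 1) (hv : ¬ IsVertex (pt a b)) :
    ∃ p q, IsEdge p q ∧ q - p = zeta ∧ pt a b ∈ openSegment ℝ p q := by
  have hb := fract_pos_of_ne_int (b := b) fun n hn => hv (by rw [ha, hn]; exact isVertex_fst_odd m n)
  have hd : pt (2 * m + 1) (⌊b⌋ + 1) - pt (2 * m + 1) ⌊b⌋ = zeta := by simp only [pt]; push_cast; ring
  refine ⟨_, _, isEdge_fst_odd m ⌊b⌋, hd, ?_⟩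
  have := mem_openSegment_of_fract (a := pt (2 * m + 1) ⌊b⌋) (b := pt (2 * m + 1) (⌊b⌋ + 1))
    _ hb (Int.fract_lt_one b)
  convert this using 1
  rw [hd, ha]
  have hbb := congrArg (fun x : ℝ => (x : ℂ)) (Int.floor_add_fract b)
  simp only [pt]
  push_cast at hbb ⊢
  linear_combination -zeta * hbb

theorem exists_edge_of_snd_odd {m : ℤ} {a b : ℝ} (hb : b = 2 * m + 1) (hv : ¬ IsVertex (pt a b)) :
    ∃ p q, IsEdge p q ∧ q - p = 1 ∧ pt a b ∈ openSegment ℝ p q := by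
  have ha := fract_pos_of_ne_int (b := a) fun n hn => hv (by rw [hb, hn]; exact isVertex_snd_odd m n)
  have hd : pt (⌊a⌋ + 1) (2 * m + 1) - pt ⌊a⌋ (2 * m + 1) = 1 := by simp only [pt]; push_cast; ring
  refine ⟨_, _, isEdge_snd_odd m ⌊a⌋, hd, ?_⟩
  have := mem_openSegment_of_fract (a := pt ⌊a⌋ (2 * m + 1)) (b := pt (⌊a⌋ + 1) (2 * m + 1))
    _ ha (Int.fract_lt_one a)
  convert this using 1
  rw [hd, hb]
  have haa := congrArg (fun x : ℝ => (x : ℂ)) (Int.floor_add_fract a)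
  simp only [pt]
  push_cast at haa ⊢
  linear_combination -haa

theorem exists_edge_of_sum_odd {m : ℤ} {a b : ℝ} (hab : a + b = 2 * m + 1)
    (hv : ¬ IsVertex (pt a b)) :
    ∃ p q, IsEdge p q ∧ q - p = 1 - zeta ∧ pt a b ∈ openSegment ℝ p q := by
  obtain rfl : b = 2 * m + 1 - a := by linarith
  have ha := fract_pos_of_ne_int (b := a) fun n hn => hv (by rw [hn]; exact isVertex_sum_odd m n)
  have hd : pt (⌊a⌋ + 1) (2 * m - ⌊a⌋) - pt ⌊a⌋ (2 * m + 1 - ⌊a⌋) = 1 - zeta := by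
    simp only [pt]; push_cast; ring
  have hE : IsEdge (pt ⌊a⌋ (2 * m + 1 - ⌊a⌋)) (pt (⌊a⌋ + 1) (2 * m - ⌊a⌋)) := by
    obtain ⟨c, hc, k, h⟩ := isEdge_sum_odd m (⌊a⌋ + 1)
    refine ⟨c, hc, k, ?_⟩
    push_cast at h
    rw [show (2 : ℝ) * m + 1 - (⌊a⌋ + 1) = 2 * m - ⌊a⌋ by ring,
      show (⌊a⌋ : ℝ) + 1 - 1 = ⌊a⌋ by ring,
      show (2 : ℝ) * m + 2 - (⌊a⌋ + 1) = 2 * m + 1 - ⌊a⌋ by ring] at h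
    rcases h with h | h
    · exact Or.inr h.symm
    · exact Or.inl h.symm
  refine ⟨_, _, hE, hd, ?_⟩
  have := mem_openSegment_of_fract (a := pt ⌊a⌋ (2 * m + 1 - ⌊a⌋))
    (b := pt (⌊a⌋ + 1) (2 * m - ⌊a⌋)) _ ha (Int.fract_lt_one a)
  convert this using 1
  rw [hd]
  have haa := congrArg (fun x : ℝ => (x : ℂ)) (Int.floor_add_fract a)
  simp only [pt]
  push_cast at haa ⊢
  linear_combination (zeta - 1) * haa

/-- The point with lattice coordinates `(a, b)` is on none of the lines that carry the edges: these
are the lines on which one of `a`, `b` and `a + b` is a given odd integer. -/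
def OffLines (a b : ℝ) : Prop := ∀ m : ℤ, a ≠ 2 * m + 1 ∧ b ≠ 2 * m + 1 ∧ a + b ≠ 2 * m + 1

theorem OffLines.notMem_openSegment {a b : ℝ} (h : OffLines a b) {p q : ℂ} (hpq : IsEdge p q) :
    pt a b ∉ openSegment ℝ p q := by
  have key : ∀ (m n : ℤ) (k : ℕ), pt a b ∉ openSegment ℝ (pt (2 * m) (2 * n) + zeta ^ k)
      (pt (2 * m) (2 * n) + zeta ^ (k + 1)) := by
    rintro m n k ⟨s, t, hs, ht, hst, hp⟩
    obtain rfl : s = 1 - t := by linarith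
    rcases zeta_pow_cases k with ⟨h1, h2⟩ | ⟨h1, h2⟩ | ⟨h1, h2⟩ | ⟨h1, h2⟩ | ⟨h1, h2⟩ | ⟨h1, h2⟩ <;>
    · simp only [h1, h2, pt_add, Complex.real_smul, real_mul_pt, pt_inj] at hp
      obtain ⟨hp1, hp2⟩ := hp
      have f0 := h m
      have f1 := h (m - 1)
      have g0 := h n
      have g1 := h (n - 1)
      have e0 := h (m + n)
      have e1 := h (m + n - 1)
      push_cast at f0 f1 g0 g1 e0 e1
      first
        | exact f0.1 (by linarith) | exact f1.1 (by linarith)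
        | exact g0.2.1 (by linarith) | exact g1.2.1 (by linarith)
        | exact e0.2.2 (by linarith) | exact e1.2.2 (by linarith)
  obtain ⟨c, hc, k, ⟨rfl, rfl⟩ | ⟨rfl, rfl⟩⟩ := hpq <;>
    obtain ⟨m, n, rfl⟩ := (isHexCenter_iff c).1 hc
  · exact key m n k
  · rw [openSegment_symm]; exact key m n k

theorem refract_zeta_pt (x y : ℝ) : refract zeta (pt x y) = pt x (-(x + y)) := by
  rw [refract, map_div₀]
  have : conj zeta ≠ 0 := by simpa using zeta_ne_zero
  rw [conj_zeta] at this ⊢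
  simp only [pt, map_add, map_mul, Complex.conj_ofReal, conj_zeta]
  field_simp
  push_cast
  linear_combination -(x : ℂ) * zeta_sq

theorem refract_one_pt (x y : ℝ) : refract 1 (pt x y) = pt (-(x + y)) y := by
  rw [refract]
  simp only [pt, div_one, map_add, map_mul, Complex.conj_ofReal, conj_zeta]
  push_cast
  ring

theorem refract_one_sub_zeta_pt (x y : ℝ) : refract (1 - zeta) (pt x y) = pt y x := by
  have := zeta_ne_zero
  rw [refract, map_div₀, ← conj_zeta, Complex.conj_conj]
  simp only [pt, map_add, map_mul, Complex.conj_ofReal, conj_zeta]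
  field_simp
  linear_combination -((x : ℂ) + y) * zeta_sq

/-! ### Uniqueness of the refractive flow -/

theorem IsEdge.sub_ne_zero {a b : ℂ} (h : IsEdge a b) : b - a ≠ 0 := by
  have h1 : zeta - 1 ≠ 0 := by rw [← zeta_sq]; exact pow_ne_zero _ zeta_ne_zero
  have h2 : ∀ k, zeta ^ k * (zeta - 1) ≠ 0 := fun k => mul_ne_zero (pow_ne_zero _ zeta_ne_zero) h1
  obtain ⟨c, -, k, ⟨rfl, rfl⟩ | ⟨rfl, rfl⟩⟩ := h
  · convert h2 k using 1; ring
  · rw [← neg_ne_zero]; convert h2 k using 1; ring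

theorem refract_refract {u : ℂ} (hu : u ≠ 0) (v : ℂ) : refract u (refract u v) = v := by
  have h : conj u ≠ 0 := by simpa using hu
  simp only [refract, map_div₀, map_neg, map_mul, Complex.conj_conj]
  field_simp

theorem IsIncoming.eq_of_fst_eq {x y : UnitTangent} {v : Circle} (hx : IsIncoming x v)
    (hy : IsIncoming y v) (hxy : x.1 = y.1) : x = y := by
  refine Prod.ext hxy ?_
  by_cases h : ∀ a b, IsEdge a b → x.1 ∉ openSegment ℝ a b
  · rw [← hx.1 h, ← hy.1 (hxy ▸ h)]
  · push Not at h
    obtain ⟨a, b, hab, hm⟩ := h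
    exact Circle.ext ((hx.2 a b hab hm).trans (hy.2 a b hab (hxy ▸ hm)).symm)

theorem IsIncoming.unique {x : UnitTangent} {v w : Circle} (hv : IsIncoming x v)
    (hw : IsIncoming x w) : v = w := by
  by_cases h : ∀ a b, IsEdge a b → x.1 ∉ openSegment ℝ a b
  · rw [hv.1 h, hw.1 h]
  · push Not at h
    obtain ⟨a, b, hab, hm⟩ := h
    have h1 := congrArg (refract (b - a)) ((hv.2 a b hab hm).symm.trans (hw.2 a b hab hm))
    rw [refract_refract hab.sub_ne_zero, refract_refract hab.sub_ne_zero] at h1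
    exact Circle.ext h1

/-- The map `Γ` follows the refractive flow near the time `t`. -/
def FollowsFlowAt (Γ : ℝ → UnitTangent) (t : ℝ) : Prop :=
  (∀ᶠ s in 𝓝[>] t, Γ s = ((Γ t).1 + ((s - t : ℝ) : ℂ) * ((Γ t).2 : ℂ), (Γ t).2)) ∧
  ∃ v : Circle, IsIncoming (Γ t) v ∧
    ∀ᶠ s in 𝓝[<] t, Γ s = ((Γ t).1 + ((s - t : ℝ) : ℂ) * (v : ℂ), v)

theorem IsTrajectory.followsFlowAt {Γ : ℝ → UnitTangent} (hΓ : IsTrajectory Γ) (t : ℝ) :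
    FollowsFlowAt Γ t :=
  ⟨hΓ.outgoing t, hΓ.incoming t⟩

theorem FollowsFlowAt.eventually_eq {Γ₁ Γ₂ : ℝ → UnitTangent} {t : ℝ} (h₁ : FollowsFlowAt Γ₁ t)
    (h₂ : FollowsFlowAt Γ₂ t) (h : Γ₁ t = Γ₂ t) : ∀ᶠ s in 𝓝 t, Γ₁ s = Γ₂ s := by
  obtain ⟨o₁, v₁, i₁, l₁⟩ := h₁
  obtain ⟨o₂, v₂, i₂, l₂⟩ := h₂
  rw [h] at i₁ l₁ o₁
  obtain rfl := i₁.unique i₂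
  have hl : ∀ᶠ s in 𝓝[<] t, Γ₁ s = Γ₂ s := by
    filter_upwards [l₁, l₂] with s h1 h2 using h1.trans h2.symm
  have hr : ∀ᶠ s in 𝓝[>] t, Γ₁ s = Γ₂ s := by
    filter_upwards [o₁, o₂] with s h1 h2 using h1.trans h2.symm
  rw [← nhdsNE_sup_pure, ← nhdsLT_sup_nhdsGT]
  exact Filter.eventually_sup.2 ⟨Filter.eventually_sup.2 ⟨hl, hr⟩, Filter.eventually_pure.2 h⟩

theorem FollowsFlowAt.eq_of_frequently {Γ₁ Γ₂ : ℝ → UnitTangent} {t : ℝ}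
    (h₁ : FollowsFlowAt Γ₁ t) (h₂ : FollowsFlowAt Γ₂ t) (h : ∃ᶠ s in 𝓝 t, Γ₁ s = Γ₂ s) :
    Γ₁ t = Γ₂ t := by
  obtain ⟨o₁, v₁, i₁, l₁⟩ := h₁
  obtain ⟨o₂, v₂, i₂, l₂⟩ := h₂
  rw [← nhdsNE_sup_pure, ← nhdsLT_sup_nhdsGT, Filter.frequently_sup, Filter.frequently_sup,
    Filter.frequently_pure] at h
  rcases h with (h | h) | h
  · obtain ⟨s, hs, h1, h2⟩ := (h.and_eventually (l₁.and l₂)).exists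
    rw [h1, h2, Prod.mk.injEq] at hs
    obtain ⟨hs1, rfl⟩ := hs
    exact i₁.eq_of_fst_eq i₂ (add_right_cancel hs1)
  · obtain ⟨s, hs, h1, h2⟩ := (h.and_eventually (o₁.and o₂)).exists
    rw [h1, h2, Prod.mk.injEq] at hs
    obtain ⟨hs1, hs2⟩ := hs
    rw [hs2] at hs1
    exact Prod.ext (add_right_cancel hs1) hs2
  · exact h

/-- Two maps that follow the flow on an interval and agree at one time agree on the interval. -/
theorem eqOn_of_followsFlowAt {Γ₁ Γ₂ : ℝ → UnitTangent} {I : Set ℝ} (hI : IsPreconnected I)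
    (h₁ : ∀ t ∈ I, FollowsFlowAt Γ₁ t) (h₂ : ∀ t ∈ I, FollowsFlowAt Γ₂ t) {t₀ : ℝ} (ht₀ : t₀ ∈ I)
    (h : Γ₁ t₀ = Γ₂ t₀) : Set.EqOn Γ₁ Γ₂ I := by
  have hnear : ∀ t ∈ I, Γ₁ t = Γ₂ t → t ∈ interior {s | Γ₁ s = Γ₂ s} := fun t ht hs =>
    mem_interior_iff_mem_nhds.2 ((h₁ t ht).eventually_eq (h₂ t ht) hs)
  have := hI.subset_of_closure_inter_subset (u := interior {s | Γ₁ s = Γ₂ s}) isOpen_interior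
    ⟨t₀, ht₀, hnear t₀ ht₀ h⟩ (by
      rintro t ⟨htc, ht⟩
      refine hnear t ht ((h₁ t ht).eq_of_frequently (h₂ t ht) ?_)
      exact (mem_closure_iff_frequently.1 htc).mono fun s hs => (interior_subset hs : s ∈ {s | Γ₁ s = Γ₂ s}))
  exact fun t ht => (interior_subset (this ht) : _)

theorem IsTrajectory.eq_of_eq_at {Γ₁ Γ₂ : ℝ → UnitTangent} (h₁ : IsTrajectory Γ₁)
    (h₂ : IsTrajectory Γ₂) {t₀ : ℝ} (h : Γ₁ t₀ = Γ₂ t₀) : Γ₁ = Γ₂ :=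
  funext fun t => eqOn_of_followsFlowAt isPreconnected_univ (fun t _ => h₁.followsFlowAt t)
    (fun t _ => h₂.followsFlowAt t) (Set.mem_univ t₀) h (Set.mem_univ t)

theorem followsFlowAt_line (p : ℂ) (u : Circle) (t₀ t : ℝ)
    (h : ∀ a b, IsEdge a b → p + ((t - t₀ : ℝ) : ℂ) * u ∉ openSegment ℝ a b) :
    FollowsFlowAt (fun s => (p + ((s - t₀ : ℝ) : ℂ) * (u : ℂ), u)) t := by
  have hline : ∀ s : ℝ, ((p + ((s - t₀ : ℝ) : ℂ) * (u : ℂ), u) : UnitTangent) =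
      (p + ((t - t₀ : ℝ) : ℂ) * (u : ℂ) + ((s - t : ℝ) : ℂ) * (u : ℂ), u) := by
    intro s
    refine Prod.ext ?_ rfl
    push_cast
    ring
  exact ⟨Eventually.of_forall hline, u,
    ⟨fun _ => rfl, fun a b hab hm => absurd hm (h a b hab)⟩, Eventually.of_forall hline⟩

/-- A trajectory is straight as long as the straight line through it does not meet an edge. -/
theorem IsTrajectory.eq_line {Γ : ℝ → UnitTangent} (hΓ : IsTrajectory Γ) {t₀ t₁ t₂ : ℝ}
    (h₁ : t₁ < t₀) (h₂ : t₀ < t₂)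
    (h : ∀ s, t₁ < s → s < t₂ → ∀ a b, IsEdge a b →
      (Γ t₀).1 + ((s - t₀ : ℝ) : ℂ) * (Γ t₀).2 ∉ openSegment ℝ a b) {s : ℝ} (hs₁ : t₁ < s)
    (hs₂ : s < t₂) : Γ s = ((Γ t₀).1 + ((s - t₀ : ℝ) : ℂ) * ((Γ t₀).2 : ℂ), (Γ t₀).2) :=
  eqOn_of_followsFlowAt (I := Set.Ioo t₁ t₂) isPreconnected_Ioo
    (fun t _ => hΓ.followsFlowAt t)
    (fun t ht => followsFlowAt_line _ _ t₀ t (h t ht.1 ht.2)) ⟨h₁, h₂⟩ (by simp) ⟨hs₁, hs₂⟩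

/-- At the end of a straight piece that does not meet an edge in its interior, a trajectory arrives
in the direction of that piece. -/
theorem IsTrajectory.arrives {Γ : ℝ → UnitTangent} (hΓ : IsTrajectory Γ) {t₀ L : ℝ} (hL : 0 < L)
    (h : ∀ s, 0 < s → s < L → ∀ a b, IsEdge a b →
      (Γ t₀).1 + (s : ℂ) * (Γ t₀).2 ∉ openSegment ℝ a b) :
    (Γ (t₀ + L)).1 = (Γ t₀).1 + (L : ℂ) * (Γ t₀).2 ∧ IsIncoming (Γ (t₀ + L)) (Γ t₀).2 := by
  obtain ⟨s₀, hs, hs0, hsL⟩ := ((hΓ.outgoing t₀).and (Ioo_mem_nhdsGT (show t₀ < t₀ + L by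
    linarith))).exists
  have hline : ∀ s, t₀ < s → s < t₀ + L →
      Γ s = ((Γ t₀).1 + ((s - t₀ : ℝ) : ℂ) * ((Γ t₀).2 : ℂ), (Γ t₀).2) := by
    intro s h1 h2
    have key : ∀ r : ℝ, (Γ s₀).1 + ((r - s₀ : ℝ) : ℂ) * ((Γ s₀).2 : ℂ) =
        (Γ t₀).1 + ((r - t₀ : ℝ) : ℂ) * ((Γ t₀).2 : ℂ) := by
      intro r
      rw [hs]
      push_cast
      ring
    have := hΓ.eq_line hs0 hsL (fun r hr1 hr2 a b hab => by
      rw [key]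
      exact h (r - t₀) (by linarith) (by linarith) a b hab) h1 h2
    rw [key] at this
    rw [this, hs]
  obtain ⟨v, hv, hleft⟩ := hΓ.incoming (t₀ + L)
  obtain ⟨s, hs', hs1, hs2⟩ := (hleft.and (Ioo_mem_nhdsLT (show t₀ < t₀ + L by
    linarith))).exists
  have h3 := (hs'.symm.trans (hline s hs1 hs2))
  rw [Prod.mk.injEq] at h3
  obtain ⟨h3, rfl⟩ := h3
  refine ⟨?_, hv⟩
  push_cast at h3
  linear_combination h3

theorem IsTrajectory.continuous {Γ : ℝ → UnitTangent} (hΓ : IsTrajectory Γ) :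
    Continuous fun t => (Γ t).1 := by
  rw [continuous_iff_continuousAt]
  intro t
  rw [continuousAt_iff_continuous_left'_right']
  have key : ∀ (F : Filter ℝ) (v : ℂ), F ≤ 𝓝 t →
      (∀ᶠ s in F, (Γ s).1 = (Γ t).1 + ((s - t : ℝ) : ℂ) * v) →
      Tendsto (fun s => (Γ s).1) F (𝓝 (Γ t).1) := by
    intro F v hF h
    have h1 : ContinuousAt (fun s : ℝ => (Γ t).1 + ((s - t : ℝ) : ℂ) * v) t := by fun_prop
    have h2 : Tendsto (fun s : ℝ => (Γ t).1 + ((s - t : ℝ) : ℂ) * v) F (𝓝 (Γ t).1) := by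
      simpa using h1.tendsto.mono_left hF
    exact h2.congr' (h.mono fun s hs => hs.symm)
  obtain ⟨v, -, hv⟩ := hΓ.incoming t
  exact ⟨key _ v nhdsWithin_le_nhds (hv.mono fun s hs => by rw [hs]),
    key _ (Γ t).2 nhdsWithin_le_nhds ((hΓ.outgoing t).mono fun s hs => by rw [hs])⟩

theorem IsTrajectory.norm_sub_le {Γ : ℝ → UnitTangent} (hΓ : IsTrajectory Γ) {s t : ℝ}
    (hst : s ≤ t) : ‖(Γ t).1 - (Γ s).1‖ ≤ t - s := by
  have := norm_image_sub_le_of_norm_deriv_right_le_segment (f := fun t => (Γ t).1)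
    (f' := fun t => ((Γ t).2 : ℂ)) (C := 1) (a := s) (b := t) hΓ.continuous.continuousOn
    (fun x _ => by
      have h1 : HasDerivWithinAt (fun r : ℝ => (Γ x).1 + ((r - x : ℝ) : ℂ) * ((Γ x).2 : ℂ))
          ((Γ x).2 : ℂ) (Set.Ioi x) x := by
        have := ((((hasDerivAt_id x).sub_const x).ofReal_comp).mul_const
          ((Γ x).2 : ℂ)).const_add (Γ x).1
        simpa using this.hasDerivWithinAt
      rw [← hasDerivWithinAt_Ioi_iff_Ici]
      refine h1.congr_of_eventuallyEq ((hΓ.outgoing x).mono fun r hr => ?_) (by simp)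
      simp only [hr])
    (fun x _ => (Circle.norm_coe _).le) t ⟨hst, le_rfl⟩
  simpa using this

/-! ### Crossing one hexagon and the next triangle -/

/-- The trajectory `Γ` is at `p` with direction `u` at the time `t`. -/
def HasState (Γ : ℝ → UnitTangent) (t : ℝ) (p u : ℂ) : Prop :=
  (Γ t).1 = p ∧ ((Γ t).2 : ℂ) = u

/-- The numbers `a`, `a'` lie in the closed interval between the consecutive odd numbers `2 i - 1`
and `2 i + 1`, and the open segment between them lies in the open interval. -/
def InStrip (i : ℤ) (a a' : ℝ) : Prop :=
  (2 * i - 1 ≤ a ∧ a ≤ 2 * i + 1) ∧ (2 * i - 1 ≤ a' ∧ a' ≤ 2 * i + 1) ∧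
    2 * (2 * i - 1) < a + a' ∧ a + a' < 2 * (2 * i + 1)

theorem ne_odd_of_mem_Ioo {i : ℤ} {a : ℝ} (h1 : 2 * i - 1 < a) (h2 : a < 2 * i + 1) (m : ℤ) :
    a ≠ 2 * m + 1 := by
  rintro rfl
  have h3 : 2 * i - 1 < 2 * m + 1 := by exact_mod_cast h1
  have h4 : 2 * m + 1 < 2 * i + 1 := by exact_mod_cast h2
  omega

theorem InStrip.ne_odd {i : ℤ} {a a' r : ℝ} (h : InStrip i a a') (h0 : 0 < r) (h1 : r < 1) (m : ℤ) :
    a + r * (a' - a) ≠ 2 * m + 1 := by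
  obtain ⟨⟨h2, h3⟩, ⟨h4, h5⟩, h6, h7⟩ := h
  have g0 : 0 < 1 - r := by linarith
  apply ne_odd_of_mem_Ioo (i := i)
  · rcases lt_or_ge (2 * i - 1 : ℝ) a with h | h
    · nlinarith
    · have : 2 * i - 1 < a' := by linarith
      nlinarith
  · rcases lt_or_ge a (2 * i + 1 : ℝ) with h | h
    · nlinarith
    · have : a' < 2 * i + 1 := by linarith
      nlinarith

section advance

variable {Γ : ℝ → UnitTangent} {t L a b x y a' b' : ℝ} {i j k m : ℤ}

theorem IsTrajectory.advance (hΓ : IsTrajectory Γ) (h : HasState Γ t (pt a b) (pt x y))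
    (hL : 0 < L) (ha : a + L * x = a') (hb : b + L * y = b') (hi : InStrip i a a')
    (hj : InStrip j b b') (hk : InStrip k (a + b) (a' + b')) :
    (Γ (t + L)).1 = pt a' b' ∧ IsIncoming (Γ (t + L)) (Γ t).2 := by
  have := hΓ.arrives (t₀ := t) hL (fun s h0 h1 p q hpq => by
    rw [h.1, h.2, real_mul_pt, pt_add]
    refine OffLines.notMem_openSegment (fun m => ?_) hpq
    have r0 : 0 < s / L := by positivity
    have r1 : s / L < 1 := (div_lt_one hL).2 h1
    have e : s = s / L * L := by field_simp
    have e1 : s * x = s / L * (a' - a) := by rw [← ha]; linear_combination x * e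
    have e2 : s * y = s / L * (b' - b) := by rw [← hb]; linear_combination y * e
    rw [e1, e2]
    refine ⟨hi.ne_odd r0 r1 m, hj.ne_odd r0 r1 m, ?_⟩
    have := hk.ne_odd r0 r1 m
    contrapose! this
    linarith)
  rwa [h.1, h.2, real_mul_pt, pt_add, ha, hb] at this

theorem IsTrajectory.advance_within (hΓ : IsTrajectory Γ)
    (h : HasState Γ t (pt a b) (pt x y))
    (hL : 0 < L) (ha : a + L * x = a') (hb : b + L * y = b') (hi : InStrip i a a')
    (hj : InStrip j b b') (hk : InStrip k (a + b) (a' + b')) (hoff : OffLines a' b') :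
    HasState Γ (t + L) (pt a' b') (pt x y) := by
  obtain ⟨h1, h2⟩ := hΓ.advance h hL ha hb hi hj hk
  exact ⟨h1, by rw [← h2.1 fun p q hpq => h1 ▸ hoff.notMem_openSegment hpq, h.2]⟩

/-- A straight piece that ends on a line `a = 2 m + 1` ends inside an edge, since a trajectory meets
no vertex, and is refracted there. The lemmas `cross_snd` and `cross_sum` treat the other two
families of edges. -/
theorem IsTrajectory.cross_fst (hΓ : IsTrajectory Γ) (h : HasState Γ t (pt a b) (pt x y))
    (hL : 0 < L) (ha : a + L * x = a') (hb : b + L * y = b') (hi : InStrip i a a')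
    (hj : InStrip j b b') (hk : InStrip k (a + b) (a' + b')) (hm : a' = 2 * m + 1) :
    HasState Γ (t + L) (pt a' b') (pt x (-(x + y))) := by
  obtain ⟨h1, h2⟩ := hΓ.advance h hL ha hb hi hj hk
  obtain ⟨p, q, hpq, hd, hmem⟩ := exists_edge_of_fst_odd hm (h1 ▸ hΓ.not_vertex _)
  exact ⟨h1, by rw [h2.2 p q hpq (h1 ▸ hmem), hd, h.2, refract_zeta_pt]⟩

theorem IsTrajectory.cross_snd (hΓ : IsTrajectory Γ) (h : HasState Γ t (pt a b) (pt x y))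
    (hL : 0 < L) (ha : a + L * x = a') (hb : b + L * y = b') (hi : InStrip i a a')
    (hj : InStrip j b b') (hk : InStrip k (a + b) (a' + b')) (hm : b' = 2 * m + 1) :
    HasState Γ (t + L) (pt a' b') (pt (-(x + y)) y) := by
  obtain ⟨h1, h2⟩ := hΓ.advance h hL ha hb hi hj hk
  obtain ⟨p, q, hpq, hd, hmem⟩ := exists_edge_of_snd_odd hm (h1 ▸ hΓ.not_vertex _)
  exact ⟨h1, by rw [h2.2 p q hpq (h1 ▸ hmem), hd, h.2, refract_one_pt]⟩

theorem IsTrajectory.cross_sum (hΓ : IsTrajectory Γ) (h : HasState Γ t (pt a b) (pt x y))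
    (hL : 0 < L) (ha : a + L * x = a') (hb : b + L * y = b') (hi : InStrip i a a')
    (hj : InStrip j b b') (hk : InStrip k (a + b) (a' + b')) (hm : a' + b' = 2 * m + 1) :
    HasState Γ (t + L) (pt a' b') (pt y x) := by
  obtain ⟨h1, h2⟩ := hΓ.advance h hL ha hb hi hj hk
  obtain ⟨p, q, hpq, hd, hmem⟩ := exists_edge_of_sum_odd hm (h1 ▸ hΓ.not_vertex _)
  exact ⟨h1, by rw [h2.2 p q hpq (h1 ▸ hmem), hd, h.2, refract_one_sub_zeta_pt]⟩

end advance

theorem offLines_of_mem_Ioo {i j k : ℤ} {a b : ℝ} (ha : 2 * i - 1 < a ∧ a < 2 * i + 1)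
    (hb : 2 * j - 1 < b ∧ b < 2 * j + 1) (hab : 2 * k - 1 < a + b ∧ a + b < 2 * k + 1) :
    OffLines a b := fun m =>
  ⟨ne_odd_of_mem_Ioo ha.1 ha.2 m, ne_odd_of_mem_Ioo hb.1 hb.2 m, ne_odd_of_mem_Ioo hab.1 hab.2 m⟩

section step

variable {Γ : ℝ → UnitTangent} {t κ α σ : ℝ}

/-- A trajectory that crosses the spoke from `0` to `1 - ζ` at the distance `κ` from the center, with
direction `σ (α + (1 - α) ζ)` and `κ + α < 1`, leaves the hexagon through the side from `1` to `ζ`.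
After one triangle it crosses the spoke from `2` to `1` of the next hexagon at the distance `κ + α`
from the center `2`. It does not come from the center, as then it would meet a vertex. -/
theorem IsTrajectory.step_upper (hΓ : IsTrajectory Γ)
    (h : HasState Γ t (pt κ (-κ)) (pt (σ * α) (σ * (1 - α)))) (hσ : 0 < σ) (h0 : 0 ≤ κ)
    (hα0 : 0 ≤ α) (hlt : κ + α < 1) :
    κ ≠ 0 ∧ ∃ L, 1 / σ ≤ L ∧ L ≤ 3 / σ ∧
      HasState Γ (t + L) (pt (2 - (κ + α)) 0) (pt (σ * (1 - α)) (-σ)) := by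
  set τ : ℝ := 1 / σ with hτ
  have hτσ : τ * σ = 1 := by rw [hτ]; field_simp
  have hτ0 : 0 < τ := by positivity
  have h1α : 0 < 1 - α := by linarith
  obtain ⟨μ, hμ⟩ : ∃ μ : ℝ, μ * (1 - α) = 1 - κ - α := ⟨(1 - κ - α) / (1 - α), by field_simp⟩
  have hμ0 : 0 < μ := by
    by_contra! hle
    nlinarith
  have hμ1 : μ ≤ 1 := by
    by_contra! hle
    nlinarith
  have s1 := hΓ.cross_sum (L := τ) (a' := κ + α) (b' := 1 - κ - α) (i := 0) (j := 0) (k := 0)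
    (m := 0) h hτ0
    (by linear_combination α * hτσ) (by linear_combination (1 - α) * hτσ)
    (by norm_num [InStrip]; constructorm* _ ∧ _ <;> linarith)
    (by norm_num [InStrip]; constructorm* _ ∧ _ <;> linarith)
    (by norm_num [InStrip]) (by push_cast; ring)
  by_cases hsing : κ + α = 0
  · exfalso
    obtain ⟨rfl, rfl⟩ : κ = 0 ∧ α = 0 := ⟨by linarith, by linarith⟩
    refine hΓ.not_vertex (t + τ) ?_
    rw [s1.1]
    convert isVertex_snd_odd 0 0 using 2 <;> norm_num
  have hpos : 0 < κ + α := lt_of_le_of_ne (by linarith) (Ne.symm hsing)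
  have s2 := hΓ.cross_fst (L := μ * τ) (a' := 1) (b' := μ) (i := 0) (j := 0) (k := 1) (m := 0)
    s1 (by positivity)
    (by linear_combination μ * (1 - α) * hτσ + hμ) (by linear_combination μ * α * hτσ - hμ)
    (by norm_num [InStrip]; constructorm* _ ∧ _ <;> linarith)
    (by norm_num [InStrip]; constructorm* _ ∧ _ <;> linarith)
    (by norm_num [InStrip]; constructorm* _ ∧ _ <;> linarith) (by norm_num)
  have hκ : κ ≠ 0 := by
    rintro rfl
    obtain rfl : μ = 1 := mul_right_cancel₀ h1α.ne' (by linarith)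
    refine hΓ.not_vertex (t + τ + 1 * τ) ?_
    rw [s2.1]
    convert isVertex_snd_odd 0 1 using 2 <;> norm_num
  have hμ1' : μ < 1 := by
    rcases hμ1.lt_or_eq with h | rfl
    · exact h
    · exact absurd (by linarith) hκ
  have h3 : 0 < μ * (1 - α) := by positivity
  have h4 : μ * (1 - α) ≤ 1 := by nlinarith
  have s3 := hΓ.advance_within (L := μ * τ) (a' := 2 - (κ + α)) (b' := 0) (i := 1) (j := 0)
    (k := 1) s2 (by positivity)
    (by linear_combination μ * (1 - α) * hτσ + hμ) (by linear_combination -μ * hτσ)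
    (by norm_num [InStrip]; constructorm* _ ∧ _ <;> linarith)
    (by norm_num [InStrip]; constructorm* _ ∧ _ <;> linarith)
    (by norm_num [InStrip]; constructorm* _ ∧ _ <;> linarith)
    (offLines_of_mem_Ioo (i := 1) (j := 0) (k := 1) (by constructor <;> norm_num <;> linarith)
      (by norm_num) (by constructor <;> norm_num <;> linarith))
  refine ⟨hκ, τ + μ * τ + μ * τ, by nlinarith, ?_, ?_⟩
  · have : (3 : ℝ) / σ = 3 * τ := by rw [hτ]; ring
    rw [this]
    nlinarith
  · rw [add_assoc, add_assoc, ← add_assoc τ] at s3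
    convert s3 using 2; ring

/-- If `κ + α > 1`, the hexagon is left through the side from `1 - ζ` to `1`, and the next spoke is
the one from `2 - 2 ζ` to `1 - 2 ζ`, crossed at the distance `κ + α - 1` from the center. -/
theorem IsTrajectory.step_lower (hΓ : IsTrajectory Γ)
    (h : HasState Γ t (pt κ (-κ)) (pt (σ * α) (σ * (1 - α)))) (hσ : 0 < σ) (h1 : κ < 1)
    (hα1 : α ≤ 1) (hlt : 1 < κ + α) :
    ∃ L, 1 / σ ≤ L ∧ L ≤ 3 / σ ∧
      HasState Γ (t + L) (pt (3 - (κ + α)) (-2)) (pt (σ * (1 - α)) (-σ)) := by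
  set τ : ℝ := 1 / σ with hτ
  have hτσ : τ * σ = 1 := by rw [hτ]; field_simp
  have hτ0 : 0 < τ := by positivity
  have hα : 0 < α := by linarith
  obtain ⟨μ, hμ⟩ : ∃ μ : ℝ, μ * α = 1 - κ := ⟨(1 - κ) / α, by field_simp⟩
  have hμ0 : 0 < μ := by
    by_contra! hle
    nlinarith
  have hμ1 : μ < 1 := by
    by_contra! hle
    nlinarith
  have s1 := hΓ.cross_fst (L := μ * τ) (a' := 1) (b' := μ - 1) (i := 0) (j := 0) (k := 0)
    (m := 0) h (by positivity)
    (by linear_combination μ * α * hτσ + hμ) (by linear_combination μ * (1 - α) * hτσ - hμ)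
    (by norm_num [InStrip]; constructorm* _ ∧ _ <;> linarith)
    (by norm_num [InStrip]; constructorm* _ ∧ _ <;> linarith)
    (by norm_num [InStrip]; constructorm* _ ∧ _ <;> linarith) (by norm_num)
  have s2 := hΓ.cross_snd (L := μ * τ) (a' := 2 - κ) (b' := -1) (i := 1) (j := 0) (k := 0)
    (m := -1) s1 (by positivity)
    (by linear_combination μ * α * hτσ + hμ) (by linear_combination -μ * hτσ)
    (by norm_num [InStrip]; constructorm* _ ∧ _ <;> linarith)
    (by norm_num [InStrip]; constructorm* _ ∧ _ <;> linarith)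
    (by norm_num [InStrip]; constructorm* _ ∧ _ <;> linarith) (by norm_num)
  have s3 := hΓ.advance_within (L := τ) (a' := 3 - (κ + α)) (b' := -2) (i := 1) (j := -1)
    (k := 0) s2 hτ0
    (by linear_combination (1 - α) * hτσ) (by linear_combination -hτσ)
    (by norm_num [InStrip]; constructorm* _ ∧ _ <;> linarith)
    (by norm_num [InStrip])
    (by norm_num [InStrip]; constructorm* _ ∧ _ <;> linarith)
    (offLines_of_mem_Ioo (i := 1) (j := -1) (k := 0) (by constructor <;> norm_num <;> linarith)
      (by norm_num) (by constructor <;> norm_num <;> linarith))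
  refine ⟨μ * τ + μ * τ + τ, by nlinarith, ?_, ?_⟩
  · have : (3 : ℝ) / σ = 3 * τ := by rw [hτ]; ring
    rw [this]
    nlinarith
  · rw [add_assoc, add_assoc, ← add_assoc (μ * τ)] at s3
    convert s3 using 2 <;> ring

/-- If `κ + α = 1`, the line meets the vertex `1`. -/
theorem IsTrajectory.step_ne_one (hΓ : IsTrajectory Γ)
    (h : HasState Γ t (pt κ (-κ)) (pt (σ * α) (σ * (1 - α)))) (hσ : 0 < σ) (h0 : 0 ≤ κ)
    (h1 : κ < 1) : κ + α ≠ 1 := by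
  intro hα
  obtain rfl : α = 1 - κ := by linarith
  have hτ : 1 / σ * σ = 1 := by field_simp
  have := hΓ.advance (L := 1 / σ) (a' := 1) (b' := 0) (i := 0) (j := 0) (k := 0) h (by positivity)
    (by linear_combination (1 - κ) * hτ) (by linear_combination κ * hτ)
    (by norm_num [InStrip]; constructorm* _ ∧ _ <;> linarith)
    (by norm_num [InStrip]; constructorm* _ ∧ _ <;> linarith)
    (by norm_num [InStrip])
  refine hΓ.not_vertex (t + 1 / σ) ?_
  rw [this.1]
  convert isVertex_fst_odd 0 0 using 2 <;> norm_num

end step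

/-! ### Symmetries of the tiling -/

/-- The linear isometry `L` followed by the translation by `τ` is a symmetry of the tiling, and `L`
commutes with refraction. -/
structure IsTilingSymmetry (L : ℂ ≃ₗᵢ[ℝ] ℂ) (τ : ℂ) : Prop where
  refract_map : ∀ u v, refract (L u) (L v) = L (refract u v)
  isEdge_iff : ∀ a b, IsEdge (L a + τ) (L b + τ) ↔ IsEdge a b

/-- The action of a linear isometry on unit vectors. -/
noncomputable def mapCircle (L : ℂ ≃ₗᵢ[ℝ] ℂ) (u : Circle) : Circle :=
  ⟨L u, mem_sphere_zero_iff_norm.2 (by rw [L.norm_map, Circle.norm_coe])⟩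

/-- The image of a trajectory under `z ↦ L z + τ`. -/
noncomputable def moved (L : ℂ ≃ₗᵢ[ℝ] ℂ) (τ : ℂ) (Γ : ℝ → UnitTangent) (t : ℝ) : UnitTangent :=
  (L (Γ t).1 + τ, mapCircle L (Γ t).2)

theorem coe_mapCircle (L : ℂ ≃ₗᵢ[ℝ] ℂ) (u : Circle) : (mapCircle L u : ℂ) = L u := rfl

theorem moved_apply (L : ℂ ≃ₗᵢ[ℝ] ℂ) (τ : ℂ) (Γ : ℝ → UnitTangent) (t : ℝ) :
    moved L τ Γ t = (L (Γ t).1 + τ, mapCircle L (Γ t).2) := rfl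

theorem map_add_mem_openSegment_iff (L : ℂ ≃ₗᵢ[ℝ] ℂ) (τ p a b : ℂ) :
    L p + τ ∈ openSegment ℝ (L a + τ) (L b + τ) ↔ p ∈ openSegment ℝ a b := by
  constructor
  · rintro ⟨s, t, hs, ht, hst, h⟩
    refine ⟨s, t, hs, ht, hst, L.injective ?_⟩
    have h1 : (s : ℂ) + t = 1 := by exact_mod_cast hst
    simp only [map_add, map_smul] at h ⊢
    simp only [Complex.real_smul] at h ⊢
    linear_combination h - τ * h1
  · rintro ⟨s, t, hs, ht, hst, rfl⟩
    refine ⟨s, t, hs, ht, hst, ?_⟩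
    have h1 : (s : ℂ) + t = 1 := by exact_mod_cast hst
    simp only [map_add, map_smul]
    simp only [Complex.real_smul]
    linear_combination τ * h1

theorem IsTrajectory.moved {Γ : ℝ → UnitTangent} (hΓ : IsTrajectory Γ) {L : ℂ ≃ₗᵢ[ℝ] ℂ} {τ : ℂ}
    (hL : IsTilingSymmetry L τ) : IsTrajectory (moved L τ Γ) := by
  have hsurj : ∀ a, ∃ a', a = L a' + τ := fun a =>
    ⟨L.symm (a - τ), by rw [L.apply_symm_apply]; ring⟩
  have hline : ∀ (p : ℂ) (s : ℝ) (v : Circle),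
      ((L (p + (s : ℂ) * v) + τ, mapCircle L v) : UnitTangent) =
        (L p + τ + (s : ℂ) * (mapCircle L v : ℂ), mapCircle L v) := by
    intro p s v
    refine Prod.ext ?_ rfl
    simp only [coe_mapCircle, ← Complex.real_smul, map_add, map_smul]
    ring
  constructor
  · intro t hv
    rw [isVertex_iff_exists_isEdge] at hv
    obtain ⟨b, hb⟩ := hv
    obtain ⟨b, rfl⟩ := hsurj b
    exact hΓ.not_vertex t ((isVertex_iff_exists_isEdge _).2 ⟨b, (hL.isEdge_iff _ _).1 hb⟩)
  · intro t
    filter_upwards [hΓ.outgoing t] with s hs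
    rw [moved_apply, hs]
    exact hline _ _ _
  · intro t
    obtain ⟨v, ⟨h1, h2⟩, hv⟩ := hΓ.incoming t
    refine ⟨mapCircle L v, ⟨?_, ?_⟩, ?_⟩
    · intro h
      have := h1 fun a b hab hm => h _ _ ((hL.isEdge_iff a b).2 hab)
        ((map_add_mem_openSegment_iff L τ _ _ _).2 hm)
      rw [this]
      rfl
    · intro a b hab hm
      obtain ⟨a, rfl⟩ := hsurj a
      obtain ⟨b, rfl⟩ := hsurj b
      have := h2 a b ((hL.isEdge_iff a b).1 hab)
        ((map_add_mem_openSegment_iff L τ _ _ _).1 hm)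
      rw [moved_apply, coe_mapCircle, coe_mapCircle, this, add_sub_add_right_eq_sub, ← map_sub,
        hL.refract_map]
    · filter_upwards [hv] with s hs
      rw [moved_apply, hs]
      exact hline _ _ _

theorem refract_mul_mul {r : ℂ} (hr : r ≠ 0) (u v : ℂ) :
    refract (r * u) (r * v) = r * refract u v := by
  rw [refract, refract, mul_div_mul_left _ _ hr]
  ring

theorem refract_conj (u v : ℂ) : refract (conj u) (conj v) = conj (refract u v) := by
  simp [refract]

theorem IsEdge.add {a b d : ℂ} (h : IsEdge a b) (hd : IsHexCenter d) :
    IsEdge (a + d) (b + d) := by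
  obtain ⟨c, hc, k, h⟩ := h
  refine ⟨c + d, hc.add hd, k, ?_⟩
  rcases h with ⟨rfl, rfl⟩ | ⟨rfl, rfl⟩
  · exact Or.inl ⟨by ring, by ring⟩
  · exact Or.inr ⟨by ring, by ring⟩

theorem IsEdge.zeta_pow_mul {a b : ℂ} (h : IsEdge a b) (m : ℕ) :
    IsEdge (zeta ^ m * a) (zeta ^ m * b) := by
  obtain ⟨c, hc, k, h⟩ := h
  refine ⟨zeta ^ m * c, hc.zeta_pow_mul m, m + k, ?_⟩
  rcases h with ⟨rfl, rfl⟩ | ⟨rfl, rfl⟩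
  · exact Or.inl ⟨by ring, by ring⟩
  · exact Or.inr ⟨by ring, by ring⟩

theorem IsEdge.zeta_mul_conj {a b : ℂ} (h : IsEdge a b) :
    IsEdge (zeta * conj a) (zeta * conj b) := by
  obtain ⟨c, hc, k, h⟩ := h
  have hinv : ∀ j, conj (zeta ^ j) = zeta ^ (5 * j) := by
    intro j
    rw [map_pow, pow_mul]
    congr 1
    rw [conj_zeta]
    linear_combination -zeta ^ 2 * zeta_cube + zeta_sq
  have h6 : ∀ j, zeta ^ (5 * j + 6) = zeta ^ (5 * j) := fun j => by
    rw [pow_add, zeta_pow_six, mul_one]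
  refine ⟨zeta * conj c, hc.zeta_mul_conj, 5 * (k + 1) + 1, ?_⟩
  have e1 : zeta * conj (c + zeta ^ k) = zeta * conj c + zeta ^ (5 * (k + 1) + 1 + 1) := by
    rw [map_add, hinv, mul_add]
    congr 1
    calc zeta * zeta ^ (5 * k) = zeta * zeta ^ (5 * k + 6) := by rw [h6]
      _ = _ := by ring
  have e2 : zeta * conj (c + zeta ^ (k + 1)) = zeta * conj c + zeta ^ (5 * (k + 1) + 1) := by
    rw [map_add, hinv, mul_add]
    ring
  rcases h with ⟨rfl, rfl⟩ | ⟨rfl, rfl⟩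
  · exact Or.inr ⟨e1, e2⟩
  · exact Or.inl ⟨e2, e1⟩

theorem IsHexCenter.isTranslationalSymmetry {d : ℂ} (hd : IsHexCenter d) :
    IsTranslationalSymmetry d := fun a b =>
  ⟨fun h => h.add hd, fun h => by simpa using h.add hd.neg⟩

theorem isTilingSymmetry_translation {τ : ℂ} (hτ : IsTranslationalSymmetry τ) :
    IsTilingSymmetry (LinearIsometryEquiv.refl ℝ ℂ) τ :=
  ⟨fun _ _ => rfl, fun a b => (hτ a b).symm⟩

/-- The unit complex number `ζ ^ k`. -/
noncomputable def zetaCircle (k : ℕ) : Circle :=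
  ⟨zeta ^ k, mem_sphere_zero_iff_norm.2 (by rw [norm_pow, norm_zeta, one_pow])⟩

theorem rotation_zetaCircle (k : ℕ) (z : ℂ) : rotation (zetaCircle k) z = zeta ^ k * z := rfl

theorem isTilingSymmetry_rotation (k : ℕ) {d : ℂ} (hd : IsHexCenter d) :
    IsTilingSymmetry (rotation (zetaCircle k)) d := by
  refine ⟨fun u v => refract_mul_mul (pow_ne_zero k zeta_ne_zero) u v, fun a b => ?_⟩
  rw [rotation_zetaCircle, rotation_zetaCircle, ← hd.isTranslationalSymmetry]
  refine ⟨fun h => ?_, fun h => h.zeta_pow_mul k⟩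
  have h5 : zeta ^ (5 * k) * zeta ^ k = 1 := by
    rw [← pow_add, show 5 * k + k = 6 * k by ring, pow_mul, zeta_pow_six, one_pow]
  have := h.zeta_pow_mul (5 * k)
  rwa [← mul_assoc, ← mul_assoc, h5, one_mul, one_mul] at this

/-- The reflection that exchanges the two lattice coordinates. -/
noncomputable def coordSwap : ℂ ≃ₗᵢ[ℝ] ℂ := Complex.conjLIE.trans (rotation (zetaCircle 1))

theorem coordSwap_apply (z : ℂ) : coordSwap z = zeta * conj z := by
  change zeta ^ 1 * conj z = _
  rw [pow_one]

theorem coordSwap_pt (a b : ℝ) : coordSwap (pt a b) = pt b a := by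
  rw [coordSwap_apply, zeta_mul_conj_pt]

theorem coordSwap_coordSwap (z : ℂ) : coordSwap (coordSwap z) = z := by
  obtain ⟨a, b, rfl⟩ := exists_eq_pt z
  rw [coordSwap_pt, coordSwap_pt]

theorem isTilingSymmetry_coordSwap : IsTilingSymmetry coordSwap 0 := by
  refine ⟨fun u v => ?_, fun a b => ?_⟩
  · simp only [coordSwap_apply, refract_mul_mul zeta_ne_zero, refract_conj]
  · rw [add_zero, add_zero]
    refine ⟨fun h => ?_, fun h => ?_⟩
    · have := h.zeta_mul_conj
      rwa [← coordSwap_apply, ← coordSwap_apply, coordSwap_coordSwap, coordSwap_coordSwap] at this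
    · rw [coordSwap_apply, coordSwap_apply]
      exact h.zeta_mul_conj

/-- A trajectory can be seen from the hexagon with center `d`, turned by a multiple of `π / 3`. -/
theorem exists_frame {d : ℂ} (hd : IsHexCenter d) (k : ℕ) :
    ∃ L τ, IsTilingSymmetry L τ ∧ ∀ Γ t p u,
      HasState (moved L τ Γ) t p u ↔ HasState Γ t (d + zeta ^ k * p) (zeta ^ k * u) := by
  have h5 : zeta ^ (5 * k) * zeta ^ k = 1 := by
    rw [← pow_add, show 5 * k + k = 6 * k by ring, pow_mul, zeta_pow_six, one_pow]
  have hd' : IsHexCenter (zeta ^ (5 * k) * -d) := hd.neg.zeta_pow_mul _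
  refine ⟨_, _, isTilingSymmetry_rotation (5 * k) hd', fun Γ t p u => ?_⟩
  simp only [HasState, moved_apply, coe_mapCircle, rotation_zetaCircle]
  refine and_congr ⟨fun h => ?_, fun h => ?_⟩ ⟨fun h => ?_, fun h => ?_⟩
  · rw [← h]; linear_combination -((Γ t).1 - d) * h5
  · rw [h]; linear_combination p * h5
  · rw [← h]; linear_combination -((Γ t).2 : ℂ) * h5
  · rw [h]; linear_combination u * h5

/-! ### The sequence of hexagons along a trajectory -/

/-- The center of the `n`-th hexagon on the way, relative to the initial hexagon. -/
noncomputable def hexCenter (α κ : ℝ) (n : ℕ) : ℂ :=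
  ∑ k ∈ Finset.range n, zeta ^ (4 * k) * (2 - 2 * zeta * (sturmian α κ k : ℂ))

theorem isHexCenter_two_sub (s : ℤ) : IsHexCenter (2 - 2 * zeta * s) :=
  (isHexCenter_iff _).2 ⟨1, -s, by simp only [pt]; push_cast; ring⟩

theorem isHexCenter_hexCenter (α κ : ℝ) (n : ℕ) : IsHexCenter (hexCenter α κ n) := by
  induction n with
  | zero => simpa [hexCenter] using isHexCenter_zero
  | succ n ih =>
    rw [hexCenter, Finset.sum_range_succ]
    exact ih.add ((isHexCenter_two_sub _).zeta_pow_mul _)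

theorem norm_pt_neg {κ : ℝ} (h0 : 0 ≤ κ) : ‖pt κ (-κ)‖ = κ := by
  have h := norm_pt_sq κ (-κ)
  have h1 : ‖pt κ (-κ)‖ ^ 2 = κ ^ 2 := by rw [h]; ring
  exact (sq_eq_sq₀ (norm_nonneg _) h0).1 h1

theorem zeta_pow_four_mul_pt (a b : ℝ) : zeta ^ 4 * pt a b = pt b (-(a + b)) := by
  rw [zeta_pow_values.2.2.2.2.1]
  simp only [pt]
  push_cast
  linear_combination -(b : ℂ) * zeta_sq

section orbit

variable {Γ : ℝ → UnitTangent} {t κ α σ : ℝ}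

/-- The two cases of a step in one formula: `κ` is replaced by the fractional part of `κ + α`, in the
frame of the next hexagon, which is turned by `ζ ^ 4`. -/
theorem IsTrajectory.step (hΓ : IsTrajectory Γ)
    (h : HasState Γ t (pt κ (-κ)) (pt (σ * α) (σ * (1 - α)))) (hσ : 0 < σ) (h0 : 0 ≤ κ)
    (h1 : κ < 1) (hα0 : 0 ≤ α) (hα1 : α ≤ 1) :
    ∃ L, 1 / σ ≤ L ∧ L ≤ 3 / σ ∧
      HasState Γ (t + L)
        (2 - 2 * zeta * (⌊κ + α⌋ : ℂ) + zeta ^ 4 * pt (Int.fract (κ + α)) (-Int.fract (κ + α)))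
        (zeta ^ 4 * pt (σ * α) (σ * (1 - α))) := by
  have hv : zeta ^ 4 * pt (σ * α) (σ * (1 - α)) = pt (σ * (1 - α)) (-σ) := by
    rw [zeta_pow_four_mul_pt]; congr 1; ring
  rw [hv, zeta_pow_four_mul_pt]
  rcases lt_or_gt_of_ne (hΓ.step_ne_one h hσ h0 h1) with hlt | hlt
  · obtain ⟨-, L, hL1, hL2, hs⟩ := hΓ.step_upper h hσ h0 hα0 hlt
    refine ⟨L, hL1, hL2, ?_⟩
    have hfl : ⌊κ + α⌋ = 0 := Int.floor_eq_zero_iff.2 ⟨by linarith, hlt⟩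
    have hfr : Int.fract (κ + α) = κ + α := Int.fract_eq_self.2 ⟨by linarith, hlt⟩
    rw [hfl, hfr]
    convert hs using 1
    simp only [pt]
    push_cast
    ring
  · obtain ⟨L, hL1, hL2, hs⟩ := hΓ.step_lower h hσ h1 hα1 hlt
    refine ⟨L, hL1, hL2, ?_⟩
    have hfl : ⌊κ + α⌋ = 1 := by
      rw [Int.floor_eq_iff]
      push_cast
      constructor <;> linarith
    have hfr : Int.fract (κ + α) = κ + α - 1 := by
      rw [Int.fract, hfl]
      push_cast
      rfl
    rw [hfl, hfr]
    convert hs using 1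
    simp only [pt]
    push_cast
    ring

theorem sturmian_eq_floor_fract (α κ : ℝ) (n : ℕ) :
    sturmian α κ n = ⌊Int.fract (κ + n * α) + α⌋ := by
  have : κ + (n + 1) * α = Int.fract (κ + n * α) + α + ⌊κ + n * α⌋ := by
    rw [Int.fract]; ring
  rw [sturmian, this, Int.floor_add_intCast]
  ring

theorem fract_add_succ_mul (α κ : ℝ) (n : ℕ) :
    Int.fract (Int.fract (κ + n * α) + α) = Int.fract (κ + (n + 1 : ℕ) * α) := by
  have : κ + (n + 1 : ℕ) * α = Int.fract (κ + n * α) + α + ⌊κ + n * α⌋ := by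
    rw [Int.fract]; push_cast; ring
  rw [this, Int.fract_add_intCast]

/-- The intercept of a trajectory on a spoke moves by the rotation by `α`, the direction is turned
by `-2π / 3` in each step, and the hexagon moves by one of two vectors, turned accordingly. -/
theorem IsTrajectory.exists_times (hΓ : IsTrajectory Γ)
    (h : HasState Γ t (pt κ (-κ)) (pt (σ * α) (σ * (1 - α)))) (hσ : 0 < σ) (h0 : 0 ≤ κ)
    (h1 : κ < 1) (hα0 : 0 ≤ α) (hα1 : α ≤ 1) :
    ∃ T : ℕ → ℝ, T 0 = t ∧ (∀ n, 1 / σ ≤ T (n + 1) - T n ∧ T (n + 1) - T n ≤ 3 / σ) ∧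
      ∀ n, HasState Γ (T n) (hexCenter α κ n +
        zeta ^ (4 * n) * pt (Int.fract (κ + n * α)) (-Int.fract (κ + n * α)))
        (zeta ^ (4 * n) * pt (σ * α) (σ * (1 - α))) := by
  set S : ℕ → ℝ → Prop := fun n s => HasState Γ s (hexCenter α κ n +
    zeta ^ (4 * n) * pt (Int.fract (κ + n * α)) (-Int.fract (κ + n * α)))
    (zeta ^ (4 * n) * pt (σ * α) (σ * (1 - α))) with hS
  have hstep : ∀ n s, S n s → ∃ s', 1 / σ ≤ s' - s ∧ s' - s ≤ 3 / σ ∧ S (n + 1) s' := by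
    intro n s hs
    obtain ⟨M, d, hM, hfr⟩ := exists_frame (isHexCenter_hexCenter α κ n) (4 * n)
    obtain ⟨L, hL1, hL2, hL⟩ := (hΓ.moved hM).step ((hfr _ _ _ _).2 hs) hσ (Int.fract_nonneg _)
      (Int.fract_lt_one _) hα0 hα1
    refine ⟨s + L, by linarith, by linarith, ?_⟩
    rw [hfr, fract_add_succ_mul, ← sturmian_eq_floor_fract] at hL
    convert hL using 1
    · rw [hexCenter, Finset.sum_range_succ, ← hexCenter]
      ring
    · ring
  have hS0 : S 0 t := by
    simpa [hS, hexCenter, Int.fract_eq_self.2 ⟨h0, h1⟩] using h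
  choose! f hf using hstep
  set T : ℕ → ℝ := fun n => Nat.rec t f n with hT
  have hTS : ∀ n, S n (T n) := by
    intro n
    induction n with
    | zero => exact hS0
    | succ n ih => exact (hf n (T n) ih).2.2
  exact ⟨T, rfl, fun n => ⟨(hf n (T n) (hTS n)).1, (hf n (T n) (hTS n)).2.1⟩, hTS⟩

end orbit

theorem IsTrajectory.shift {Γ : ℝ → UnitTangent} (hΓ : IsTrajectory Γ) (P : ℝ) :
    IsTrajectory fun t => Γ (t + P) := by
  have hcont : ∀ t, Tendsto (fun s => s + P) (𝓝 t) (𝓝 (t + P)) := fun t =>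
    (continuous_id.add continuous_const).continuousAt
  constructor
  · exact fun t => hΓ.not_vertex (t + P)
  · intro t
    have : Tendsto (fun s => s + P) (𝓝[>] t) (𝓝[>] (t + P)) :=
      tendsto_nhdsWithin_of_tendsto_nhds_of_eventually_within _
        ((hcont t).mono_left nhdsWithin_le_nhds)
        (by filter_upwards [self_mem_nhdsWithin] with s hs; simpa using hs)
    filter_upwards [this.eventually (hΓ.outgoing (t + P))] with s hs
    rwa [add_sub_add_right_eq_sub] at hs
  · intro t
    obtain ⟨v, hv, h⟩ := hΓ.incoming (t + P)
    have : Tendsto (fun s => s + P) (𝓝[<] t) (𝓝[<] (t + P)) :=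
      tendsto_nhdsWithin_of_tendsto_nhds_of_eventually_within _
        ((hcont t).mono_left nhdsWithin_le_nhds)
        (by filter_upwards [self_mem_nhdsWithin] with s hs; simpa using hs)
    refine ⟨v, hv, ?_⟩
    filter_upwards [this.eventually h] with s hs
    rwa [add_sub_add_right_eq_sub] at hs

/-- The trajectory is carried to itself, after the time `P`, by the translation by `τ`. -/
def IsShiftedBy (Γ : ℝ → UnitTangent) (P : ℝ) (τ : ℂ) : Prop :=
  ∀ t, Γ (t + P) = ((Γ t).1 + τ, (Γ t).2)

/-- By uniqueness of the flow, a trajectory that has come once to a translate of an earlier state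
repeats itself up to this translation. -/
theorem IsTrajectory.isShiftedBy {Γ : ℝ → UnitTangent} (hΓ : IsTrajectory Γ) {P t₀ : ℝ} {τ : ℂ}
    (hτ : IsTranslationalSymmetry τ) (h : Γ (t₀ + P) = ((Γ t₀).1 + τ, (Γ t₀).2)) :
    IsShiftedBy Γ P τ := by
  have := (hΓ.shift P).eq_of_eq_at (hΓ.moved (isTilingSymmetry_translation hτ)) (t₀ := t₀) h
  exact fun t => congrFun this t

theorem norm_geom_sum_zeta_le (n : ℕ) :
    ‖∑ k ∈ Finset.range n, (zeta ^ 4) ^ k‖ ≤ 2 / ‖zeta ^ 4 - 1‖ := by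
  have hw : zeta ^ 4 ≠ 1 := by
    intro h
    rw [zeta_pow_values.2.2.2.2.1, show (1 : ℂ) = pt 1 0 by simp [pt], pt_inj] at h
    norm_num at h
  rw [geom_sum_eq hw, norm_div]
  gcongr
  refine (norm_sub_le _ _).trans ?_
  rw [norm_pow, norm_pow, norm_zeta, one_pow, one_pow, norm_one]
  norm_num

theorem hexCenter_eq (α κ : ℝ) (n : ℕ) : hexCenter α κ n =
    2 * ∑ k ∈ Finset.range n, (zeta ^ 4) ^ k -
      2 * zeta * ∑ k ∈ Finset.range n, (zeta ^ 4) ^ k * (sturmian α κ k : ℂ) := by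
  rw [hexCenter, Finset.mul_sum, Finset.mul_sum, ← Finset.sum_sub_distrib]
  refine Finset.sum_congr rfl fun k _ => ?_
  rw [pow_mul]
  ring

theorem abs_add_le_two_mul_norm_pt (a b : ℝ) : |a + b| ≤ 2 * ‖pt a b‖ := by
  refine abs_le_of_sq_le_sq ?_ (by positivity)
  rw [mul_pow, norm_pt_sq]
  nlinarith [sq_nonneg a, sq_nonneg b, sq_nonneg (a + b)]

theorem letterDiff_eq (α κ : ℝ) (N : ℕ) :
    letterDiff α (κ + N * (3 * α)) = sturmian α κ (3 * N) - sturmian α κ (3 * N + 1) := by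
  have e1 : κ + N * (3 * α) = κ + (3 * N : ℕ) * α := by push_cast; ring
  have e2 : κ + (3 * N : ℕ) * α + α = κ + ((3 * N : ℕ) + 1) * α := by ring
  have e3 : κ + (3 * N : ℕ) * α + 2 * α = κ + ((3 * N + 1 : ℕ) + 1) * α := by push_cast; ring
  have e4 : κ + (3 * N + 1 : ℕ) * α = κ + ((3 * N : ℕ) + 1) * α := by push_cast; ring
  rw [letterDiff, sturmian, sturmian, e1, e2, e3, e4]
  ring

/-- The sums of the letters with indices in two residue classes modulo `3` can be recovered from
the sum twisted by the cubic character, as the character has the sum zero over a period. -/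
theorem exists_twisted_sum_eq_pt (α κ : ℝ) (N : ℕ) : ∃ y : ℝ,
    ∑ k ∈ Finset.range (3 * N), (zeta ^ 4) ^ k * (sturmian α κ k : ℂ) =
      pt (discrepancy α N κ - y) y := by
  induction N with
  | zero => exact ⟨0, by simp [discrepancy, pt]⟩
  | succ N ih =>
    obtain ⟨y, hy⟩ := ih
    refine ⟨y + (sturmian α κ (3 * N + 2) - sturmian α κ (3 * N + 1)), ?_⟩
    have h4 : zeta ^ 4 = -zeta := by linear_combination zeta * zeta_cube
    have p0 : (zeta ^ 4) ^ (3 * N) = 1 := by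
      rw [← pow_mul, show 4 * (3 * N) = 6 * (2 * N) by ring, pow_mul, zeta_pow_six, one_pow]
    have p1 : (zeta ^ 4) ^ (3 * N + 1) = -zeta := by
      rw [pow_succ (zeta ^ 4) (3 * N), p0, one_mul, h4]
    have p2 : (zeta ^ 4) ^ (3 * N + 1 + 1) = zeta ^ 2 := by
      rw [pow_succ (zeta ^ 4) (3 * N + 1), p1, h4]
      ring
    rw [show 3 * (N + 1) = 3 * N + 1 + 1 + 1 by ring, Finset.sum_range_succ,
      Finset.sum_range_succ, Finset.sum_range_succ, hy, p0, p1, p2, discrepancy,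
      discrepancy, Finset.sum_range_succ, letterDiff_eq]
    simp only [pt]
    push_cast
    linear_combination (sturmian α κ (3 * N + 2) : ℂ) * zeta_sq

theorem hexCenter_unbounded {α : ℝ} (hα : Irrational α) (κ C : ℝ) :
    ∃ n, C < ‖hexCenter α κ n‖ := by
  by_contra! hC
  set G : ℝ := 2 / ‖zeta ^ 4 - 1‖ with hG
  obtain ⟨N, hN⟩ := discrepancy_unbounded hα κ ⌈C + 2 * G⌉
  obtain ⟨y, hy⟩ := exists_twisted_sum_eq_pt α κ N
  have h1 := norm_geom_sum_zeta_le (3 * N)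
  have h2 := hC (3 * N)
  rw [hexCenter_eq] at h2
  have h3 := norm_sub_norm_le
    (2 * zeta * ∑ k ∈ Finset.range (3 * N), (zeta ^ 4) ^ k * (sturmian α κ k : ℂ))
    (2 * ∑ k ∈ Finset.range (3 * N), (zeta ^ 4) ^ k)
  rw [norm_sub_rev] at h2
  have h5 : ‖2 * zeta * ∑ k ∈ Finset.range (3 * N), (zeta ^ 4) ^ k * (sturmian α κ k : ℂ)‖ =
      2 * ‖pt (discrepancy α N κ - y) y‖ := by
    rw [hy, norm_mul, norm_mul, norm_zeta, mul_one, Complex.norm_two]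
  rw [h5, norm_mul, Complex.norm_two] at h3
  have h4 := abs_add_le_two_mul_norm_pt (discrepancy α N κ - y) y
  rw [sub_add_cancel] at h4
  have h6 : C + 2 * G < |(discrepancy α N κ : ℝ)| := by
    have := Int.le_ceil (C + 2 * G)
    refine lt_of_le_of_lt this ?_
    exact_mod_cast hN
  linarith

theorem hexCenter_sublinear {α : ℝ} (hα : Irrational α) (κ : ℝ) {ε : ℝ} (hε : 0 < ε) :
    ∃ C : ℝ, ∀ n : ℕ, ‖hexCenter α κ n‖ ≤ ε * n + C := by
  have hw : zeta ^ 4 ≠ 1 := by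
    intro h
    rw [zeta_pow_values.2.2.2.2.1, show (1 : ℂ) = pt 1 0 by simp [pt], pt_inj] at h
    norm_num at h
  have hw3 : (zeta ^ 4) ^ 3 = 1 := by
    rw [← pow_mul, show 4 * 3 = 6 * 2 by norm_num, pow_mul, zeta_pow_six, one_pow]
  obtain ⟨C, hC⟩ := sturmian_twisted_sum_sublinear hα κ hw3 hw (half_pos hε)
  refine ⟨2 * (2 / ‖zeta ^ 4 - 1‖) + 2 * C, fun n => ?_⟩
  have h1 := norm_geom_sum_zeta_le n
  rw [hexCenter_eq]
  refine (norm_sub_le _ _).trans ?_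
  rw [norm_mul, norm_mul, norm_mul, norm_zeta, mul_one, Complex.norm_two]
  linarith [hC n]

section dichotomy

variable {Γ : ℝ → UnitTangent} {t κ α σ : ℝ}

/-- For a rational rotation number `α` the intercept is periodic, and after three of its periods the
frame is turned by a multiple of `2π`. -/
theorem IsTrajectory.isShiftedBy_of_rat (hΓ : IsTrajectory Γ)
    (h : HasState Γ t (pt κ (-κ)) (pt (σ * α) (σ * (1 - α)))) (hσ : 0 < σ) (h0 : 0 ≤ κ)
    (h1 : κ < 1) (hα0 : 0 ≤ α) (hα1 : α ≤ 1) (hα : ¬ Irrational α) :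
    ∃ P > 0, ∃ τ, IsHexCenter τ ∧ IsShiftedBy Γ P τ := by
  obtain ⟨T, rfl, hT, hst⟩ := hΓ.exists_times h hσ h0 h1 hα0 hα1
  obtain ⟨q, rfl⟩ : ∃ q : ℚ, (q : ℝ) = α := by simpa [Irrational] using hα
  have hTmono : StrictMono T := strictMono_nat_of_lt_succ fun n => by
    have := (hT n).1
    have : 0 < 1 / σ := by positivity
    linarith
  have hn : 0 < 3 * q.den := by have := q.den_pos; omega
  refine ⟨T (3 * q.den) - T 0, sub_pos.2 (hTmono hn), hexCenter q κ (3 * q.den),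
    isHexCenter_hexCenter _ _ _, hΓ.isShiftedBy (t₀ := T 0)
      (isHexCenter_hexCenter _ _ _).isTranslationalSymmetry ?_⟩
  have hs := hst (3 * q.den)
  have hz : zeta ^ (4 * (3 * q.den)) = 1 := by
    rw [show 4 * (3 * q.den) = 6 * (2 * q.den) by ring, pow_mul, zeta_pow_six, one_pow]
  have hfr : Int.fract (κ + (3 * q.den : ℕ) * (q : ℝ)) = κ := by
    have : ((3 * q.den : ℕ) : ℝ) * (q : ℝ) = (3 * q.num : ℤ) := by
      have hq : (q.den : ℝ) * q = q.num := by exact_mod_cast Rat.den_mul_eq_num q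
      push_cast
      rw [mul_assoc, hq]
    rw [this, Int.fract_add_intCast, Int.fract_eq_self.2 ⟨h0, h1⟩]
  rw [hz, hfr, one_mul, one_mul] at hs
  rw [add_sub_cancel]
  refine Prod.ext ?_ (Circle.ext ?_)
  · rw [hs.1, h.1, add_comm]
  · exact hs.2.trans h.2.symm

theorem IsTrajectory.not_isBounded_of_irrational (hΓ : IsTrajectory Γ)
    (h : HasState Γ t (pt κ (-κ)) (pt (σ * α) (σ * (1 - α)))) (hσ : 0 < σ) (h0 : 0 ≤ κ)
    (h1 : κ < 1) (hα0 : 0 ≤ α) (hα1 : α ≤ 1) (hα : Irrational α) :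
    ¬ IsBoundedTrajectory Γ := by
  obtain ⟨T, rfl, hT, hst⟩ := hΓ.exists_times h hσ h0 h1 hα0 hα1
  intro hb
  obtain ⟨C, hC⟩ := hb.exists_norm_le
  obtain ⟨n, hn⟩ := hexCenter_unbounded hα κ (C + 1)
  have h2 := hC _ ⟨T n, rfl⟩
  have h3 := norm_sub_norm_le (hexCenter α κ n)
    (-(zeta ^ (4 * n) * pt (Int.fract (κ + n * α)) (-Int.fract (κ + n * α))))
  simp only [(hst n).1] at h2
  rw [sub_neg_eq_add, norm_neg, norm_mul, norm_pow, norm_zeta, one_pow, one_mul,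
    norm_pt_neg (Int.fract_nonneg _)] at h3
  linarith [Int.fract_lt_one (κ + n * α)]

theorem IsTrajectory.tendsto_zero_of_irrational (hΓ : IsTrajectory Γ)
    (h : HasState Γ t (pt κ (-κ)) (pt (σ * α) (σ * (1 - α)))) (hσ : 0 < σ) (h0 : 0 ≤ κ)
    (h1 : κ < 1) (hα0 : 0 ≤ α) (hα1 : α ≤ 1) (hα : Irrational α) :
    Tendsto (fun s : ℝ => ‖(Γ s).1‖ / s) atTop (𝓝 0) := by
  obtain ⟨T, rfl, hT, hst⟩ := hΓ.exists_times h hσ h0 h1 hα0 hα1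
  have hTlin : ∀ n : ℕ, T 0 + n / σ ≤ T n := by
    intro n
    induction n with
    | zero => simp
    | succ n ih =>
      have := (hT n).1
      push_cast
      rw [add_div]
      linarith
  rw [Metric.tendsto_atTop]
  intro ε hε
  obtain ⟨C, hC⟩ := hexCenter_sublinear hα κ (show 0 < ε / (2 * σ) by positivity)
  set C' : ℝ := C + 1 + 3 / σ - ε / 2 * T 0 with hC'
  refine ⟨max (T 0) (max 1 (2 * C' / ε + 1)), fun s hs => ?_⟩
  have hs0 : T 0 ≤ s := (le_max_left _ _).trans hs
  have hs1 : 1 ≤ s := ((le_max_left _ _).trans (le_max_right _ _)).trans hs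
  have hs2 : 2 * C' / ε + 1 ≤ s := ((le_max_right _ _).trans (le_max_right _ _)).trans hs
  obtain ⟨n, hn1, hn2⟩ : ∃ n, T n ≤ s ∧ s < T (n + 1) := by
    have hex : ∃ n, s < T (n + 1) := by
      obtain ⟨n, hn⟩ := exists_nat_gt ((s - T 0) * σ)
      refine ⟨n, lt_of_lt_of_le ?_ (hTlin (n + 1))⟩
      rw [← sub_lt_iff_lt_add', lt_div_iff₀ hσ]
      push_cast
      linarith
    classical
    refine ⟨Nat.find hex, ?_, Nat.find_spec hex⟩
    rcases Nat.eq_zero_or_pos (Nat.find hex) with h | h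
    · rw [h]; exact hs0
    · have := Nat.find_min hex (Nat.sub_lt h one_pos)
      rw [Nat.sub_add_cancel (show 1 ≤ Nat.find hex from h)] at this
      exact not_lt.1 this
  have hnorm : ‖(Γ (T n)).1‖ ≤ ε / (2 * σ) * n + C + 1 := by
    rw [(hst n).1]
    refine (norm_add_le _ _).trans ?_
    rw [norm_mul, norm_pow, norm_zeta, one_pow, one_mul, norm_pt_neg (Int.fract_nonneg _)]
    linarith [hC n, Int.fract_lt_one (κ + n * α)]
  have hnσ : (n : ℝ) ≤ (s - T 0) * σ := by
    rw [← div_le_iff₀ hσ]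
    linarith [hTlin n]
  have h4 : ε / (2 * σ) * n ≤ ε / 2 * (s - T 0) := by
    calc ε / (2 * σ) * n ≤ ε / (2 * σ) * ((s - T 0) * σ) := by gcongr
      _ = ε / 2 * (s - T 0) := by field_simp
  have h5 : ‖(Γ s).1‖ ≤ ε / 2 * s + C' := by
    have h6 := hΓ.norm_sub_le hn1
    have h7 := norm_sub_norm_le (Γ s).1 (Γ (T n)).1
    linarith [(hT n).2]
  have h8 : C' < ε / 2 * s := by
    have : 2 * C' / ε < s := by linarith
    rw [div_lt_iff₀ hε] at this
    linarith
  have hspos : 0 < s := by linarith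
  rw [Real.dist_eq, sub_zero, abs_of_nonneg (by positivity), div_lt_iff₀ hspos]
  linarith

end dichotomy

/-! ### Reaching a hexagon -/

theorem IsTrajectory.eventually_hasState {Γ : ℝ → UnitTangent} (hΓ : IsTrajectory Γ) {t a b x y : ℝ}
    (h : HasState Γ t (pt a b) (pt x y)) :
    ∀ᶠ s in 𝓝[>] (0 : ℝ), HasState Γ (t + s) (pt (a + s * x) (b + s * y)) (pt x y) ∧
      IsIncoming (Γ (t + s)) (Γ (t + s)).2 := by
  obtain ⟨r, hr, hsub⟩ := (mem_nhdsGT_iff_exists_Ioo_subset).1 (hΓ.outgoing t)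
  have hline : ∀ s, t < s → s < r →
      Γ s = ((Γ t).1 + ((s - t : ℝ) : ℂ) * ((Γ t).2 : ℂ), (Γ t).2) := fun s h1 h2 => hsub ⟨h1, h2⟩
  have hr' : 0 < r - t := sub_pos.2 hr
  filter_upwards [Ioo_mem_nhdsGT hr'] with s hs
  have e := hline (t + s) (by linarith [hs.1]) (by linarith [hs.2])
  refine ⟨⟨?_, ?_⟩, ?_⟩
  · rw [e, h.1, h.2, add_sub_cancel_left, real_mul_pt, pt_add]
  · rw [e, h.2]
  · obtain ⟨v, hv, hleft⟩ := hΓ.incoming (t + s)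
    obtain ⟨q, hq, hq1, hq2⟩ := (hleft.and (Ioo_mem_nhdsLT (show t < t + s by
      linarith [hs.1]))).exists
    have e' := hline q hq1 (hq2.trans (by linarith [hs.2]))
    have : v = (Γ (t + s)).2 := by
      rw [e]
      exact congrArg Prod.snd (hq.symm.trans e')
    rwa [this] at hv

theorem eventually_ne_odd (f : ℝ) {g : ℝ} (hg : g ≠ 0) :
    ∀ᶠ s in 𝓝[>] (0 : ℝ), ∀ m : ℤ, f + s * g ≠ 2 * m + 1 := by
  have hg' : 0 < |g| := abs_pos.2 hg
  have h1 : 0 < 1 / |g| := by positivity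
  by_cases hex : ∃ s₁, 0 < s₁ ∧ s₁ < 1 / |g| ∧ ∃ m : ℤ, f + s₁ * g = 2 * m + 1
  · obtain ⟨s₁, h0, h2, m, hm⟩ := hex
    filter_upwards [Ioo_mem_nhdsGT h0] with s hs m' hm'
    have h3 : |(m : ℝ) - m'| < 1 := by
      have e : (m : ℝ) - m' = (s₁ - s) * g / 2 := by linarith
      rw [lt_div_iff₀ hg'] at h2
      rw [e, abs_div, abs_mul, abs_of_pos (show 0 < s₁ - s by linarith [hs.2]), abs_two]
      have : s * |g| > 0 := mul_pos hs.1 hg'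
      linarith
    have h4 : m = m' := by
      have : |m - m'| < 1 := by exact_mod_cast h3
      have := Int.abs_lt_one_iff.1 this
      omega
    subst h4
    have h5 : (s₁ - s) * g = 0 := by linarith
    rcases mul_eq_zero.1 h5 with h6 | h6
    · linarith [hs.2]
    · exact hg h6
  · push Not at hex
    filter_upwards [Ioo_mem_nhdsGT h1] with s hs m using hex s hs.1 hs.2 m

theorem HasState.direction_ne_zero {Γ : ℝ → UnitTangent} {t x y : ℝ} {p : ℂ}
    (h : HasState Γ t p (pt x y)) : ¬ (x = 0 ∧ y = 0) := by
  rintro ⟨rfl, rfl⟩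
  have := Circle.norm_coe (Γ t).2
  rw [h.2] at this
  simp [pt] at this

/-- A trajectory leaves the edges: it cannot run along an edge, as refraction there would reverse
its direction. -/
theorem IsTrajectory.exists_offLines {Γ : ℝ → UnitTangent} (hΓ : IsTrajectory Γ) :
    ∃ t a b x y, HasState Γ t (pt a b) (pt x y) ∧ OffLines a b := by
  obtain ⟨a, b, hp⟩ := exists_eq_pt (Γ 0).1
  obtain ⟨x, y, hu⟩ := exists_eq_pt ((Γ 0).2 : ℂ)
  have hev : ∀ f g : ℝ, ∀ᶠ s in 𝓝[>] (0 : ℝ), g ≠ 0 → ∀ m : ℤ, f + s * g ≠ 2 * m + 1 := by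
    intro f g
    by_cases hg : g = 0
    · simp [hg]
    · exact (eventually_ne_odd f hg).mono fun s hs _ => hs
  obtain ⟨s, ⟨hs, hin⟩, ha, hb, hab⟩ := ((hΓ.eventually_hasState ⟨hp, hu⟩).and
    ((hev a x).and ((hev b y).and (hev (a + b) (x + y))))).exists
  have hnv := hΓ.not_vertex (0 + s)
  rw [hs.1] at hnv
  have hne := hs.direction_ne_zero
  refine ⟨0 + s, _, _, _, _, hs, fun m => ⟨fun hm => ?_, fun hm => ?_, fun hm => ?_⟩⟩
  · by_cases hx : x = 0
    · obtain ⟨p, q, hpq, hd, hmem⟩ := exists_edge_of_fst_odd hm hnv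
      have := hin.2 p q hpq (hs.1 ▸ hmem)
      rw [hd, hs.2, refract_zeta_pt, pt_inj] at this
      exact hne ⟨hx, by linarith⟩
    · exact ha hx m hm
  · by_cases hy : y = 0
    · obtain ⟨p, q, hpq, hd, hmem⟩ := exists_edge_of_snd_odd hm hnv
      have := hin.2 p q hpq (hs.1 ▸ hmem)
      rw [hd, hs.2, refract_one_pt, pt_inj] at this
      exact hne ⟨by linarith, hy⟩
    · exact hb hy m hm
  · by_cases hxy : x + y = 0
    · obtain ⟨p, q, hpq, hd, hmem⟩ := exists_edge_of_sum_odd hm hnv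
      have := hin.2 p q hpq (hs.1 ▸ hmem)
      rw [hd, hs.2, refract_one_sub_zeta_pt, pt_inj] at this
      exact hne ⟨by linarith, by linarith⟩
    · exact hab hxy m (by linarith)

/-- The open hexagon of the tiling with center at the origin. -/
def InHexagon (p : ℂ) : Prop :=
  ∃ a b : ℝ, p = pt a b ∧ (-1 < a ∧ a < 1) ∧ (-1 < b ∧ b < 1) ∧ (-1 < a + b ∧ a + b < 1)

theorem InHexagon.zeta_pow_mul {p : ℂ} (h : InHexagon p) (k : ℕ) : InHexagon (zeta ^ k * p) := by
  induction k with
  | zero => simpa using h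
  | succ k ih =>
    obtain ⟨a, b, hp, ha, hb, hab⟩ := ih
    refine ⟨-b, a + b, ?_, ⟨by linarith, by linarith⟩, hab, ⟨by linarith, by linarith⟩⟩
    rw [pow_succ', mul_assoc, hp, zeta_mul_pt]

theorem eventually_lt_add_mul {c b : ℝ} (y : ℝ) (h : c < b) :
    ∀ᶠ s in 𝓝[>] (0 : ℝ), c < b + s * y := by
  have : ContinuousAt (fun s : ℝ => b + s * y) 0 := by fun_prop
  exact nhdsWithin_le_nhds (this.eventually (lt_mem_nhds (by simpa using h)))

theorem eventually_add_mul_lt {c b : ℝ} (y : ℝ) (h : b < c) :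
    ∀ᶠ s in 𝓝[>] (0 : ℝ), b + s * y < c := by
  have : ContinuousAt (fun s : ℝ => b + s * y) 0 := by fun_prop
  exact nhdsWithin_le_nhds (this.eventually (gt_mem_nhds (by simpa using h)))

/-- Affine functions that are positive at the beginning, one of which decreases, have a first
common exit time. -/
theorem exists_first_exit {ι : Type*} [Fintype ι] (f g : ι → ℝ) (hf : ∀ i, 0 < f i)
    (hg : ∃ i, g i < 0) : ∃ L, 0 < L ∧ (∀ i, 0 ≤ f i + L * g i) ∧ ∃ i, f i + L * g i = 0 := by
  classical
  obtain ⟨i₀, hi₀⟩ := hg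
  obtain ⟨i, hi, hmin⟩ := Finset.exists_min_image (Finset.univ.filter fun i => g i < 0)
    (fun i => f i / -g i) ⟨i₀, by simp [hi₀]⟩
  simp only [Finset.mem_filter, Finset.mem_univ, true_and] at hi hmin
  have hi' : 0 < -g i := by linarith
  have hL : 0 < f i / -g i := div_pos (hf i) hi'
  refine ⟨f i / -g i, hL, fun j => ?_, i, ?_⟩
  · rcases lt_or_ge (g j) 0 with hj | hj
    · have h1 := hmin j hj
      rw [le_div_iff₀ (by linarith)] at h1
      linarith
    · have := (hf j).le
      positivity
  · have hgi : g i ≠ 0 := hi.ne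
    field_simp
    ring

/-- A trajectory inside the triangle with vertices `1`, `ζ`, `1 + ζ` leaves it into a hexagon. -/
theorem IsTrajectory.exists_hexagon_of_triangle {Γ : ℝ → UnitTangent} (hΓ : IsTrajectory Γ)
    {t a b x y : ℝ} (h : HasState Γ t (pt a b) (pt x y)) (ha : a < 1) (hb : b < 1)
    (hab : 1 < a + b) : ∃ t d p u, IsHexCenter d ∧ HasState Γ t (d + p) u ∧ InHexagon p := by
  obtain ⟨L, hL, hpos, i, hi⟩ := exists_first_exit ![1 - a, 1 - b, a + b - 1] ![-x, -y, x + y]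
    (by
      intro i
      fin_cases i <;> simp <;> linarith)
    (by
      by_contra! hle
      have h0 := hle 0
      have h1 := hle 1
      have h2 := hle 2
      simp at h0 h1 h2
      exact h.direction_ne_zero ⟨by linarith, by linarith⟩)
  have g0 := hpos 0
  have g1 := hpos 1
  have g2 := hpos 2
  simp only [Matrix.cons_val] at g0 g1 g2
  obtain ⟨a', ha'⟩ : ∃ a', a + L * x = a' := ⟨_, rfl⟩
  obtain ⟨b', hb'⟩ : ∃ b', b + L * y = b' := ⟨_, rfl⟩
  have k0 : a' ≤ 1 := by linarith
  have k1 : b' ≤ 1 := by linarith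
  have k2 : 1 ≤ a' + b' := by linarith
  have hadv := (hΓ.advance h hL ha' hb' (i := 0) (j := 0) (k := 1)
    (by norm_num [InStrip]; constructorm* _ ∧ _ <;> linarith)
    (by norm_num [InStrip]; constructorm* _ ∧ _ <;> linarith)
    (by norm_num [InStrip]; constructorm* _ ∧ _ <;> linarith)).1
  have hnv := hΓ.not_vertex (t + L)
  rw [hadv] at hnv
  have n1 : ¬ (a' = 1 ∧ b' = 1) := by
    rintro ⟨rfl, rfl⟩
    apply hnv
    convert isVertex_fst_odd 0 1 using 2 <;> norm_num
  have n2 : ¬ (a' = 1 ∧ b' = 0) := by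
    rintro ⟨rfl, rfl⟩
    apply hnv
    convert isVertex_fst_odd 0 0 using 2 <;> norm_num
  have n3 : ¬ (a' = 0 ∧ b' = 1) := by
    rintro ⟨rfl, rfl⟩
    apply hnv
    convert isVertex_snd_odd 0 0 using 2 <;> norm_num
  have strict : ∀ {c d : ℝ}, c ≤ d → c ≠ d → c < d := fun h1 h2 => lt_of_le_of_ne h1 h2
  fin_cases i
  · -- the exit is through the side from `1` to `1 + ζ`
    simp at hi
    obtain rfl : a' = 1 := by linarith
    have hb1 : b' < 1 := strict k1 fun h => n1 ⟨rfl, h⟩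
    have hb0 : 0 < b' := strict (by linarith) fun h => n2 ⟨rfl, h.symm⟩
    have hx : 0 < x := pos_of_mul_pos_right (show 0 < L * x by linarith) hL.le
    have hs := hΓ.cross_fst (m := 0) h hL ha' hb' (i := 0) (j := 0) (k := 1)
      (by norm_num [InStrip]; constructorm* _ ∧ _ <;> linarith)
      (by norm_num [InStrip]; constructorm* _ ∧ _ <;> linarith)
      (by norm_num [InStrip]; constructorm* _ ∧ _ <;> linarith) (by norm_num)
    obtain ⟨s, ⟨hs', -⟩, c1, c2, c3, c4, c5, hs0⟩ := ((hΓ.eventually_hasState hs).and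
      ((eventually_add_mul_lt (c := 3) (b := 1) x (by norm_num)).and
      ((eventually_lt_add_mul (c := -1) (-(x + y)) (show -1 < b' by linarith)).and
      ((eventually_add_mul_lt (-(x + y)) hb1).and
      ((eventually_lt_add_mul (c := 1) (-y) (show 1 < 1 + b' by linarith)).and
      ((eventually_add_mul_lt (c := 3) (-y) (show 1 + b' < 3 by linarith)).and
        (self_mem_nhdsWithin))))))).exists
    have hsx : 0 < s * x := mul_pos hs0 hx
    refine ⟨t + L + s, pt (2 * (1 : ℤ)) (2 * (0 : ℤ)), pt (1 + s * x - 2) (b' + s * (-(x + y))),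
      pt x (-(x + y)),
      (isHexCenter_iff _).2 ⟨1, 0, rfl⟩, ?_, _, _, rfl, ⟨by linarith, by linarith⟩,
      ⟨by linarith, by linarith⟩, ⟨by linarith, by linarith⟩⟩
    convert hs' using 1
    rw [pt_add]
    push_cast
    congr 1 <;> ring
  · -- the exit is through the side from `ζ` to `1 + ζ`
    simp at hi
    obtain rfl : b' = 1 := by linarith
    have ha1 : a' < 1 := strict k0 fun h => n1 ⟨h, rfl⟩
    have ha0 : 0 < a' := strict (by linarith) fun h => n3 ⟨h.symm, rfl⟩
    have hy : 0 < y := pos_of_mul_pos_right (show 0 < L * y by linarith) hL.le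
    have hs := hΓ.cross_snd (m := 0) h hL ha' hb' (i := 0) (j := 0) (k := 1)
      (by norm_num [InStrip]; constructorm* _ ∧ _ <;> linarith)
      (by norm_num [InStrip]; constructorm* _ ∧ _ <;> linarith)
      (by norm_num [InStrip]; constructorm* _ ∧ _ <;> linarith) (by norm_num)
    obtain ⟨s, ⟨hs', -⟩, c1, c2, c3, c4, c5, hs0⟩ := ((hΓ.eventually_hasState hs).and
      ((eventually_add_mul_lt (c := 3) (b := 1) y (by norm_num)).and
      ((eventually_lt_add_mul (c := -1) (-(x + y)) (show -1 < a' by linarith)).and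
      ((eventually_add_mul_lt (-(x + y)) ha1).and
      ((eventually_lt_add_mul (c := 1) (-x) (show 1 < 1 + a' by linarith)).and
      ((eventually_add_mul_lt (c := 3) (-x) (show 1 + a' < 3 by linarith)).and
        (self_mem_nhdsWithin))))))).exists
    have hsy : 0 < s * y := mul_pos hs0 hy
    refine ⟨t + L + s, pt (2 * (0 : ℤ)) (2 * (1 : ℤ)), pt (a' + s * (-(x + y))) (1 + s * y - 2),
      pt (-(x + y)) y,
      (isHexCenter_iff _).2 ⟨0, 1, rfl⟩, ?_, _, _, rfl, ⟨by linarith, by linarith⟩,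
      ⟨by linarith, by linarith⟩, ⟨by linarith, by linarith⟩⟩
    convert hs' using 1
    rw [pt_add]
    push_cast
    congr 1 <;> ring
  · -- the exit is through the side from `1` to `ζ`
    simp at hi
    have hab' : a' + b' = 1 := by linarith
    have ha1 : a' < 1 := strict k0 fun h => n2 ⟨h, by linarith⟩
    have hb1 : b' < 1 := strict k1 fun h => n3 ⟨by linarith, h⟩
    have hxy : x + y < 0 := by
      by_contra! hle
      have := mul_nonneg hL.le hle
      linarith
    have hs := hΓ.cross_sum (m := 0) h hL ha' hb' (i := 0) (j := 0) (k := 1)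
      (by norm_num [InStrip]; constructorm* _ ∧ _ <;> linarith)
      (by norm_num [InStrip]; constructorm* _ ∧ _ <;> linarith)
      (by norm_num [InStrip]; constructorm* _ ∧ _ <;> linarith) (by push_cast; linarith)
    obtain ⟨s, ⟨hs', -⟩, c1, c2, c3, c4, c5, hs0⟩ := ((hΓ.eventually_hasState hs).and
      ((eventually_lt_add_mul (c := -1) y (show -1 < a' by linarith)).and
      ((eventually_add_mul_lt y ha1).and
      ((eventually_lt_add_mul (c := -1) x (show -1 < b' by linarith)).and
      ((eventually_add_mul_lt x hb1).and
      ((eventually_lt_add_mul (c := -1) (x + y) (show -1 < a' + b' by linarith)).and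
        (self_mem_nhdsWithin))))))).exists
    have hsxy : s * (x + y) < 0 := mul_neg_of_pos_of_neg hs0 hxy
    exact ⟨_, 0, _, _, isHexCenter_zero, by rw [zero_add]; exact hs', _, _, rfl,
      ⟨by linarith, by linarith⟩, ⟨by linarith, by linarith⟩, ⟨by linarith, by linarith⟩⟩

theorem exists_mem_Ioo_odd {a : ℝ} (h : ∀ m : ℤ, a ≠ 2 * m + 1) :
    ∃ i : ℤ, 2 * i - 1 < a ∧ a < 2 * i + 1 := by
  have h1 := Int.floor_le ((a + 1) / 2)
  have h2 := Int.lt_floor_add_one ((a + 1) / 2)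
  refine ⟨⌊(a + 1) / 2⌋, lt_of_le_of_ne (by linarith) fun heq => ?_, by linarith⟩
  apply h (⌊(a + 1) / 2⌋ - 1)
  push_cast
  linarith

theorem IsTrajectory.exists_hexagon {Γ : ℝ → UnitTangent} (hΓ : IsTrajectory Γ) :
    ∃ t d p u, IsHexCenter d ∧ HasState Γ t (d + p) u ∧ InHexagon p := by
  obtain ⟨t, a, b, x, y, h, hoff⟩ := hΓ.exists_offLines
  obtain ⟨i, hi1, hi2⟩ := exists_mem_Ioo_odd fun m => (hoff m).1
  obtain ⟨j, hj1, hj2⟩ := exists_mem_Ioo_odd fun m => (hoff m).2.1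
  obtain ⟨k, hk1, hk2⟩ := exists_mem_Ioo_odd fun m => (hoff m).2.2
  have hd : IsHexCenter (pt (2 * i) (2 * j)) := (isHexCenter_iff _).2 ⟨i, j, rfl⟩
  have hlow : i + j - 1 ≤ k := by
    have : (2 : ℝ) * (i + j) - 2 < 2 * k + 1 := by linarith
    have : 2 * (i + j) - 2 < 2 * k + 1 := by exact_mod_cast this
    omega
  have hupp : k ≤ i + j + 1 := by
    have : (2 : ℝ) * k - 1 < 2 * (i + j) + 2 := by linarith
    have : 2 * k - 1 < 2 * (i + j) + 2 := by exact_mod_cast this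
    omega
  -- the two kinds of triangles are exchanged by the half turn
  have tri : ∀ (n : ℕ) (a' b' x' y' : ℝ), pt a b = pt (2 * i) (2 * j) + zeta ^ n * pt a' b' →
      pt x y = zeta ^ n * pt x' y' → a' < 1 → b' < 1 → 1 < a' + b' →
      ∃ t d p u, IsHexCenter d ∧ HasState Γ t (d + p) u ∧ InHexagon p := by
    intro n a' b' x' y' hp hu h1 h2 h3
    obtain ⟨M, τ, hM, hfr⟩ := exists_frame hd n
    rw [hp, hu, ← hfr] at h
    obtain ⟨t', d', p, u, hd', hs, hp'⟩ := (hΓ.moved hM).exists_hexagon_of_triangle h h1 h2 h3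
    rw [hfr] at hs
    exact ⟨t', _, _, _, hd.add (hd'.zeta_pow_mul n), by rwa [mul_add, ← add_assoc] at hs,
      hp'.zeta_pow_mul n⟩
  obtain hk | hk | hk : k = i + j - 1 ∨ k = i + j ∨ k = i + j + 1 := by omega
  · refine tri 3 (2 * i - a) (2 * j - b) (-x) (-y) ?_ ?_ (by linarith) (by linarith) ?_
    · rw [zeta_cube]; simp only [pt]; push_cast; ring
    · rw [zeta_cube]; simp only [pt]; push_cast; ring
    · rw [hk] at hk2; push_cast at hk2; linarith
  · rw [hk] at hk1 hk2
    push_cast at hk1 hk2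
    exact ⟨t, _, pt (a - 2 * i) (b - 2 * j), _, hd,
      by rwa [pt_add, add_sub_cancel, add_sub_cancel],
      _, _, rfl, ⟨by linarith, by linarith⟩, ⟨by linarith, by linarith⟩,
      ⟨by linarith, by linarith⟩⟩
  · refine tri 0 (a - 2 * i) (b - 2 * j) x y ?_ ?_ (by linarith) (by linarith) ?_
    · simp only [pt]; push_cast; ring
    · simp
    · rw [hk] at hk1; push_cast at hk1; linarith

theorem exists_sector (u : ℂ) : ∃ (k : ℕ) (x y : ℝ), 0 ≤ x ∧ 0 ≤ y ∧ u = zeta ^ k * pt x y := by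
  obtain ⟨a, b, rfl⟩ := exists_eq_pt u
  have h1 := zeta_mul_pt
  have h2 : ∀ a b, zeta ^ 2 * pt a b = pt (-(a + b)) a := fun a b => by
    rw [pow_two, mul_assoc, h1, h1]; congr 1; ring
  have h3 : ∀ a b, zeta ^ 3 * pt a b = pt (-a) (-b) := fun a b => by
    rw [zeta_cube]; simp only [pt]; push_cast; ring
  have h4 := zeta_pow_four_mul_pt
  have h5 : ∀ a b, zeta ^ 5 * pt a b = pt (a + b) (-a) := fun a b => by
    rw [pow_succ', mul_assoc, h4, h1]; congr 1 <;> ring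
  rcases le_total 0 a with ha | ha <;> rcases le_total 0 b with hb | hb
  · exact ⟨0, a, b, ha, hb, by simp⟩
  · rcases le_total 0 (a + b) with hab | hab
    · exact ⟨5, -b, a + b, by linarith, hab, by rw [h5]; congr 1 <;> ring⟩
    · exact ⟨4, -(a + b), a, by linarith, ha, by rw [h4]; congr 1; ring⟩
  · rcases le_total 0 (a + b) with hab | hab
    · exact ⟨1, a + b, -a, hab, by linarith, by rw [pow_one, h1]; congr 1 <;> ring⟩
    · exact ⟨2, b, -(a + b), hb, by linarith, by rw [h2]; congr 1; ring⟩
  · exact ⟨3, -a, -b, by linarith, by linarith, by rw [h3]; congr 1 <;> ring⟩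

/-- Inside the hexagon at the origin, a line with direction in the sector spanned by `1` and `ζ`
crosses the diagonal spanned by `1 - ζ`. -/
theorem IsTrajectory.exists_spoke {Γ : ℝ → UnitTangent} (hΓ : IsTrajectory Γ) {t a b x y : ℝ}
    (h : HasState Γ t (pt a b) (pt x y)) (ha : -1 < a ∧ a < 1) (hb : -1 < b ∧ b < 1)
    (hab : -1 < a + b ∧ a + b < 1) (hx : 0 ≤ x) (hy : 0 ≤ y) :
    ∃ t' κ α σ, 0 < σ ∧ 0 ≤ α ∧ α ≤ 1 ∧ -1 < κ ∧ κ < 1 ∧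
      HasState Γ t' (pt κ (-κ)) (pt (σ * α) (σ * (1 - α))) := by
  have hσ : 0 < x + y := by
    refine lt_of_le_of_ne (by linarith) fun h0 => h.direction_ne_zero ⟨by linarith, by linarith⟩
  obtain ⟨α, hα⟩ : ∃ α, (x + y) * α = x := ⟨x / (x + y), by field_simp⟩
  obtain ⟨r, hr⟩ : ∃ r, r * (x + y) = -(a + b) := ⟨-(a + b) / (x + y), by field_simp⟩
  have hα0 : 0 ≤ α := nonneg_of_mul_nonneg_right (by linarith) hσ
  have hα1 : α ≤ 1 := by
    by_contra! hlt
    nlinarith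
  have hκ : a + r * x = (1 - α) * a - α * b := by linear_combination α * hr - r * hα
  have hκb : b + r * y = -(a + r * x) := by linear_combination hr
  have hκ1 : -1 < a + r * x := by
    rw [hκ]
    rcases hα0.eq_or_lt with rfl | h0
    · linarith
    · nlinarith
  have hκ2 : a + r * x < 1 := by
    rw [hκ]
    rcases hα0.eq_or_lt with rfl | h0
    · linarith
    · nlinarith
  refine ⟨t + r, a + r * x, α, x + y, hσ, hα0, hα1, hκ1, hκ2, ?_⟩
  have hline : ∀ s : ℝ, (Γ t).1 + (s : ℂ) * (Γ t).2 = pt (a + s * x) (b + s * y) := by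
    intro s
    rw [h.1, h.2, real_mul_pt, pt_add]
  have hx' : (x + y) * (1 - α) = y := by linear_combination -hα
  have key := eqOn_of_followsFlowAt (I := segment ℝ t (t + r)) (t₀ := t)
    (Γ₁ := Γ) (Γ₂ := fun s => ((Γ t).1 + ((s - t : ℝ) : ℂ) * ((Γ t).2 : ℂ), (Γ t).2))
    (convex_segment _ _).isPreconnected (fun s _ => hΓ.followsFlowAt s)
    (by
      rintro s ⟨θ, θ', h0, h1, hsum, rfl⟩
      refine followsFlowAt_line _ _ _ _ fun p q hpq => ?_
      obtain rfl : θ = 1 - θ' := by linarith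
      have e : (1 - θ') • t + θ' • (t + r) - t = θ' * r := by simp only [smul_eq_mul]; ring
      rw [e, hline]
      have e1 : a + θ' * r * x = (1 - θ') * a + θ' * (a + r * x) := by ring
      have e2 : b + θ' * r * y = (1 - θ') * b + θ' * (b + r * y) := by ring
      have e3 : a + θ' * r * x + (b + θ' * r * y) = (1 - θ') * (a + b) := by
        linear_combination θ' * hr
      refine (offLines_of_mem_Ioo (i := 0) (j := 0) (k := 0) ?_ ?_ ?_).notMem_openSegment hpq
      · rw [e1]
        norm_num
        rcases h1.eq_or_lt with rfl | h1
        · constructor <;> linarith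
        · constructor <;> nlinarith
      · rw [e2, hκb]
        norm_num
        rcases h1.eq_or_lt with rfl | h1
        · constructor <;> linarith
        · constructor <;> nlinarith
      · rw [e3]
        norm_num
        constructor <;> nlinarith)
    (left_mem_segment _ _ _) (by simp) (right_mem_segment ℝ t (t + r))
  refine ⟨?_, ?_⟩
  · rw [key]
    simp only
    rw [add_sub_cancel_left, hline, hκb]
  · rw [key, hα, hx']
    exact h.2

/-! ### Translated, unbounded and drift-periodic trajectories -/

theorem IsShiftedBy.tendsto {Γ : ℝ → UnitTangent} (hΓ : IsTrajectory Γ) {P : ℝ} {τ : ℂ}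
    (hP : 0 < P) (h : IsShiftedBy Γ P τ) :
    Tendsto (fun t : ℝ => ‖(Γ t).1‖ / t) atTop (𝓝 (‖τ‖ / P)) := by
  -- the motion relative to the uniform motion with velocity `τ / P` is periodic
  set g : ℝ → ℂ := fun t => (Γ t).1 - ((t / P : ℝ) : ℂ) * τ with hg
  have hper : Function.Periodic g P := by
    intro t
    have : (t + P) / P = t / P + 1 := by field_simp
    simp only [hg, h t, this]
    push_cast
    ring
  have hcont : Continuous g := by
    have := hΓ.continuous
    fun_prop
  obtain ⟨C, hC⟩ := (hper.isBounded_of_continuous hP.ne' hcont).exists_norm_le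
  have hC' : ∀ t, ‖g t‖ ≤ C := fun t => hC _ ⟨t, rfl⟩
  have hlim : Tendsto (fun t : ℝ => C / t) atTop (𝓝 0) := tendsto_const_nhds.div_atTop tendsto_id
  rw [tendsto_iff_dist_tendsto_zero]
  refine squeeze_zero' (Eventually.of_forall fun _ => dist_nonneg) ?_ hlim
  filter_upwards [eventually_gt_atTop 0] with t ht
  have h1 : ‖((t / P : ℝ) : ℂ) * τ‖ = t * (‖τ‖ / P) := by
    rw [norm_mul, Complex.norm_real, Real.norm_of_nonneg (by positivity)]
    ring
  have h2 := abs_norm_sub_norm_le (Γ t).1 (((t / P : ℝ) : ℂ) * τ)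
  rw [h1] at h2
  rw [Real.dist_eq, div_sub' ht.ne', abs_div, abs_of_pos ht]
  gcongr
  exact h2.trans (hC' t)

theorem IsBoundedTrajectory.tendsto_zero {Γ : ℝ → UnitTangent} (h : IsBoundedTrajectory Γ) :
    Tendsto (fun t : ℝ => ‖(Γ t).1‖ / t) atTop (𝓝 0) := by
  obtain ⟨C, hC⟩ := h.exists_norm_le
  refine squeeze_zero' ?_ ?_ (tendsto_const_nhds.div_atTop tendsto_id : Tendsto (fun t : ℝ => C / t)
    atTop (𝓝 0))
  · filter_upwards [eventually_gt_atTop 0] with t ht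
    positivity
  · filter_upwards [eventually_gt_atTop 0] with t ht
    gcongr
    exact hC _ ⟨t, rfl⟩

/-- Either the trajectory is invariant under a translation, possibly trivial, or it is unbounded
and has the speed `0`. -/
def HasDichotomy (Γ : ℝ → UnitTangent) : Prop :=
  (∃ P > 0, ∃ τ, IsTranslationalSymmetry τ ∧ IsShiftedBy Γ P τ) ∨
  (¬ IsBoundedTrajectory Γ ∧ Tendsto (fun t : ℝ => ‖(Γ t).1‖ / t) atTop (𝓝 0))

theorem HasDichotomy.of_moved {Γ : ℝ → UnitTangent} {L : ℂ ≃ₗᵢ[ℝ] ℂ} {d : ℂ}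
    (hL : IsTilingSymmetry L d) (h : HasDichotomy (moved L d Γ)) : HasDichotomy Γ := by
  rcases h with ⟨P, hP, τ, hτ, h⟩ | ⟨hb, ht⟩
  · refine Or.inl ⟨P, hP, L.symm τ, fun a b => ?_, fun t => ?_⟩
    · have e : ∀ a, L (a + L.symm τ) + d = L a + d + τ := fun a => by
        rw [map_add, L.apply_symm_apply]
        ring
      rw [← hL.isEdge_iff, ← hL.isEdge_iff (a + _), e, e, ← hτ]
    · have h1 := h t
      simp only [moved_apply, Prod.mk.injEq] at h1
      refine Prod.ext (L.injective ?_) (Circle.ext (L.injective ?_))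
      · simp only [map_add, L.apply_symm_apply]
        linear_combination h1.1
      · simpa only [coe_mapCircle] using congrArg (fun u : Circle => (u : ℂ)) h1.2
  · refine Or.inr ⟨fun hbd => hb ?_, ?_⟩
    · obtain ⟨C, hC⟩ := hbd.exists_norm_le
      refine isBounded_iff_forall_norm_le.2 ⟨C + ‖d‖, ?_⟩
      rintro _ ⟨t, rfl⟩
      refine (norm_add_le _ _).trans ?_
      rw [L.norm_map]
      linarith [hC _ ⟨t, rfl⟩]
    · have hlim : Tendsto (fun t : ℝ => ‖(moved L d Γ t).1‖ / t + ‖d‖ / t) atTop (𝓝 0) := by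
        simpa using ht.add (tendsto_const_nhds.div_atTop tendsto_id : Tendsto (fun t : ℝ => ‖d‖ / t)
          atTop (𝓝 0))
      refine squeeze_zero' ?_ ?_ hlim
      · filter_upwards [eventually_gt_atTop 0] with t ht
        positivity
      · filter_upwards [eventually_gt_atTop 0] with t ht
        rw [← add_div]
        gcongr
        rw [← L.norm_map, moved_apply]
        have := norm_sub_le (L (Γ t).1 + d) d
        simpa using this

theorem IsTrajectory.hasDichotomy_of_spoke {Γ : ℝ → UnitTangent} (hΓ : IsTrajectory Γ)
    {t κ α σ : ℝ} (h : HasState Γ t (pt κ (-κ)) (pt (σ * α) (σ * (1 - α)))) (hσ : 0 < σ)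
    (h0 : 0 ≤ κ) (h1 : κ < 1) (hα0 : 0 ≤ α) (hα1 : α ≤ 1) : HasDichotomy Γ := by
  by_cases hα : Irrational α
  · exact Or.inr ⟨hΓ.not_isBounded_of_irrational h hσ h0 h1 hα0 hα1 hα,
      hΓ.tendsto_zero_of_irrational h hσ h0 h1 hα0 hα1 hα⟩
  · obtain ⟨P, hP, τ, hτ, hs⟩ := hΓ.isShiftedBy_of_rat h hσ h0 h1 hα0 hα1 hα
    exact Or.inl ⟨P, hP, τ, hτ.isTranslationalSymmetry, hs⟩

theorem IsTrajectory.hasDichotomy {Γ : ℝ → UnitTangent} (hΓ : IsTrajectory Γ) :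
    HasDichotomy Γ := by
  obtain ⟨t, d, p, u, hd, hs, hp⟩ := hΓ.exists_hexagon
  obtain ⟨k, x, y, hx, hy, rfl⟩ := exists_sector u
  obtain ⟨L, τ, hL, hfr⟩ := exists_frame hd k
  have h5 : zeta ^ k * zeta ^ (5 * k) = 1 := by
    rw [← pow_add, show k + 5 * k = 6 * k by ring, pow_mul, zeta_pow_six, one_pow]
  obtain ⟨a, b, hab, h1, h2, h3⟩ := hp.zeta_pow_mul (5 * k)
  have hp' : p = zeta ^ k * pt a b := by rw [← hab, ← mul_assoc, h5, one_mul]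
  rw [hp', ← hfr] at hs
  have hΓ' := hΓ.moved hL
  refine HasDichotomy.of_moved hL ?_
  obtain ⟨t', κ, α, σ, hσ, hα0, hα1, hκ1, hκ2, hst⟩ := hΓ'.exists_spoke hs h1 h2 h3 hx hy
  rcases le_or_gt 0 κ with hκ | hκ
  · exact hΓ'.hasDichotomy_of_spoke hst hσ hκ hκ2 hα0 hα1
  · -- the line passes the center on the other side, so the picture is reflected
    refine HasDichotomy.of_moved isTilingSymmetry_coordSwap ?_
    refine (hΓ'.moved isTilingSymmetry_coordSwap).hasDichotomy_of_spoke (t := t') (κ := -κ)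
      (α := 1 - α) (σ := σ) ⟨?_, ?_⟩ hσ (by linarith) (by linarith) (by linarith) (by linarith)
    · rw [moved_apply, hst.1, coordSwap_pt, add_zero, neg_neg]
    · rw [moved_apply, coe_mapCircle, hst.2, coordSwap_pt, sub_sub_cancel]

theorem IsShiftedBy.isPeriodic {Γ : ℝ → UnitTangent} {P : ℝ} (hP : 0 < P)
    (h : IsShiftedBy Γ P 0) : IsPeriodic Γ :=
  ⟨P, hP, fun t => by rw [h t, add_zero]⟩

theorem IsShiftedBy.isDriftPeriodic {Γ : ℝ → UnitTangent} {P : ℝ} {τ : ℂ} (hτ0 : τ ≠ 0)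
    (hτ : IsTranslationalSymmetry τ) (h : IsShiftedBy Γ P τ) : IsDriftPeriodic Γ := by
  refine ⟨τ, hτ0, hτ, Set.Subset.antisymm ?_ ?_⟩
  · rintro _ ⟨_, ⟨t, rfl⟩, rfl⟩
    exact ⟨t + P, h t⟩
  · rintro _ ⟨t, rfl⟩
    refine ⟨_, ⟨t - P, rfl⟩, ?_⟩
    have := h (t - P)
    rw [sub_add_cancel] at this
    exact this.symm

theorem IsDriftPeriodic.exists_isShiftedBy {Γ : ℝ → UnitTangent} (hΓ : IsTrajectory Γ)
    (h : IsDriftPeriodic Γ) : ∃ P > 0, ∃ τ ≠ 0, IsShiftedBy Γ P τ := by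
  obtain ⟨τ, hτ0, hτ, hrange⟩ := h
  obtain ⟨P, hP⟩ : ((Γ 0).1 + τ, (Γ 0).2) ∈ Set.range Γ := by
    rw [← hrange]
    exact ⟨Γ 0, ⟨0, rfl⟩, rfl⟩
  have hs : IsShiftedBy Γ P τ := hΓ.isShiftedBy (t₀ := 0) hτ (by rw [zero_add]; exact hP)
  have hP0 : P ≠ 0 := by
    rintro rfl
    exact hτ0 (by simpa using congrArg Prod.fst hP)
  rcases lt_or_gt_of_ne hP0 with hneg | hpos
  · refine ⟨-P, by linarith, -τ, neg_ne_zero.2 hτ0, fun t => ?_⟩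
    have := hs (t + -P)
    rw [neg_add_cancel_right] at this
    rw [this]
    simp
  · exact ⟨P, hpos, τ, hτ0, hs⟩

end Trihex

theorem theorem1p6 (Γ : ℝ → Trihex.UnitTangent) (hΓ : Trihex.IsTrajectory Γ) :
    (Trihex.IsBoundedTrajectory Γ → Trihex.IsPeriodic Γ) ∧
    (¬ Trihex.IsDriftPeriodic Γ →
      Tendsto (fun t : ℝ => ‖(Γ t).1‖ / t) atTop (𝓝 0)) ∧
    (Trihex.IsDriftPeriodic Γ →
      ∃ c : ℝ, 0 < c ∧ Tendsto (fun t : ℝ => ‖(Γ t).1‖ / t) atTop (𝓝 c)) := by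
  refine ⟨fun hb => ?_, fun hd => ?_, fun hd => ?_⟩
  · rcases hΓ.hasDichotomy with ⟨P, hP, τ, -, h⟩ | ⟨hnb, -⟩
    · have hlim := tendsto_nhds_unique (h.tendsto hΓ hP) hb.tendsto_zero
      obtain rfl : τ = 0 := by simpa [hP.ne'] using hlim
      exact h.isPeriodic hP
    · exact absurd hb hnb
  · rcases hΓ.hasDichotomy with ⟨P, hP, τ, hτ, h⟩ | ⟨-, hlim⟩
    · obtain rfl : τ = 0 := by
        by_contra hτ0
        exact hd (h.isDriftPeriodic hτ0 hτ)
      simpa using h.tendsto hΓ hP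
    · exact hlim
  · obtain ⟨P, hP, τ, hτ, h⟩ := hd.exists_isShiftedBy hΓ
    exact ⟨‖τ‖ / P, div_pos (norm_pos_iff.2 hτ) hP, h.tendsto hΓ hP⟩
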